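/- Let $\Omega=[0,2\pi]\times[-\tfrac12,\tfrac12]$ with coordinates $(\theta,z)$. Let $H^k_{\mathrm{per}}(\Omega)$ denote the $L^2$-based Sobolev space of order $k$ of functions that are $2\pi$-periodic in $\theta$ and $1$-periodic in $z$. For $\phi=(\phi_\rho,\phi_\theta,\phi_z):\Omega\to\mathbb R^3$ (cylindrical components) let $$\epsilon=e(\phi_\theta,\phi_z)+\tfrac12 D\phi_\rho\otimes D\phi_\rho+\phi_\rho\,e_\theta\otimes e_\theta,\qquad e_{ij}=\tfrac12(\partial_i\phi_j+\partial_j\phi_i)\quad(i,j\in\{\theta,z\}),$$ and let the von K\'arm\'an--Donnell energy be $$E_h(\phi)=\int_\Omega|\epsilon|^2+h^2|D^2\phi_\rho|^2\,d\theta\,dz .$$ For $\lambda\in(0,1)$ and $\varrho>0$ let $$A_{\lambda,\varrho,\infty}=\{\phi:\ \phi_\rho\in H^2_{\mathrm{per}}(\Omega),\ \phi_\theta\in H^1_{\mathrm{per}}(\Omega),\ \phi_z+\lambda z\in H^1_{\mathrm{per}}(\Omega),\ \phi_\rho\ge\varrho-1\}.$$ (i) There is a numerical constant $C>0$ with the following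 property. Let $\{(h_\alpha,\lambda_\alpha,\varrho_\alpha)\}_{\alpha>0}$ satisfy $h_\alpha,\lambda_\alpha\in(0,\frac12]$ and $\varrho_\alpha\ge 1+\lambda_\alpha^{1/2}h_\alpha^{1/4}$ for all $\alpha>0$, and $h_\alpha=o\big((\varrho_\alpha-1)^{-2/3}\lambda_\alpha^{3/2}\big)$ as $\alpha\to\infty$. For each $\alpha>0$ let $\phi^\alpha$ be a minimizer of $E_{h_\alpha}$ over $A_{\lambda_\alpha,\varrho_\alpha,\infty}$. Then, for all sufficiently large $\alpha$, $$(\varrho_\alpha-1)^{1/7}h_\alpha^{-2/7}\lambda_\alpha^{3/7}\le C\,\|D\phi^\alpha_\rho\|_{L^\infty(\Omega)}$$ (the right-hand side may be $+\infty$). (ii) In particular, if $\varrho>1$ and $\lambda\in(0,\frac12]$ are fixed and $\phi^h$ minimizes $E_h$ over $A_{\lambda,\varrho,\infty}$ for each $h\in(0,\frac12]$, then $\|D\phi^h_\rho\|_{L^\infty(\Omega)}\to\infty$ as $h\to0^+$. -/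

import Mathlib

open MeasureTheory Set Filter Topology Asymptotics
open scoped ENNReal ContDiff

noncomputable section

namespace VKD

/-- The reference domain `Ω = [0, 2π] × [-1/2, 1/2]`, with coordinates `x = (θ, z)`. -/
def Omega : Set (ℝ × ℝ) := Icc 0 (2 * Real.pi) ×ˢ Icc (-(1 / 2)) (1 / 2)

/-- Lebesgue measure on `Ω`. -/
def muOmega : Measure (ℝ × ℝ) := volume.restrict Omega

/-- The reference basis vectors: index `0` is the `θ` direction, index `1` the `z` direction. -/
def basisVec : Fin 2 → ℝ × ℝ := ![(1, 0), (0, 1)]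

/-- Smooth test functions compactly supported in the interior of `Ω`. -/
def IsTestFunction (ψ : ℝ × ℝ → ℝ) : Prop :=
  ContDiff ℝ ∞ ψ ∧ HasCompactSupport ψ ∧ tsupport ψ ⊆ interior Omega

/-- Smooth functions on the plane that are `2π`-periodic in `θ` and `1`-periodic in `z`. -/
def IsPeriodicTestFunction (ψ : ℝ × ℝ → ℝ) : Prop :=
  ContDiff ℝ ∞ ψ ∧ (∀ θ z, ψ (θ + 2 * Real.pi, z) = ψ (θ, z)) ∧ (∀ θ z, ψ (θ, z + 1) = ψ (θ, z))

/-- `g` is the weak (distributional) `i`-th partial derivative of `f` in the interior of `Ω`. -/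
def IsWeakPartial (i : Fin 2) (f g : ℝ × ℝ → ℝ) : Prop :=
  LocallyIntegrableOn f (interior Omega) ∧ LocallyIntegrableOn g (interior Omega) ∧
    ∀ ψ, IsTestFunction ψ →
      ∫ x, f x * fderiv ℝ ψ x (basisVec i) ∂muOmega = -∫ x, g x * ψ x ∂muOmega

open Classical in
/-- A representative of the weak partial derivative `∂ᵢ f` (it is unique up to null sets);
the value is `0` if `f` has no weak partial derivative in this direction. -/
def weakPartial (i : Fin 2) (f : ℝ × ℝ → ℝ) : ℝ × ℝ → ℝ :=
  if H : ∃ g, IsWeakPartial i f g then Classical.choose H else 0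

/-- The Sobolev space `H¹(Ω)`. -/
def MemH1 (f : ℝ × ℝ → ℝ) : Prop :=
  MemLp f 2 muOmega ∧ ∀ i, ∃ g, MemLp g 2 muOmega ∧ IsWeakPartial i f g

/-- The periodic Sobolev space `H¹_per(Ω)`: functions in `H¹(Ω)` for which integration by parts
against smooth periodic functions produces no boundary term, i.e. whose traces on opposite
sides of `Ω` agree. -/
def MemH1Per (f : ℝ × ℝ → ℝ) : Prop :=
  MemH1 f ∧ ∀ i ψ, IsPeriodicTestFunction ψ →
    ∫ x, f x * fderiv ℝ ψ x (basisVec i) ∂muOmega = -∫ x, weakPartial i f x * ψ x ∂muOmega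

/-- The periodic Sobolev space `H²_per(Ω)`. -/
def MemH2Per (f : ℝ × ℝ → ℝ) : Prop :=
  MemH1Per f ∧ ∀ i, MemH1Per (weakPartial i f)

/-- A displacement field `φ = (φ_ρ, φ_θ, φ_z)` in cylindrical coordinates. Only the values on `Ω`
(up to null sets) matter. -/
structure Displacement where
  rho : ℝ × ℝ → ℝ
  theta : ℝ × ℝ → ℝ
  z : ℝ × ℝ → ℝ

/-- All three components `φ_ρ, φ_θ, φ_z`. -/
def Displacement.comp (φ : Displacement) : Fin 3 → ℝ × ℝ → ℝ := ![φ.rho, φ.theta, φ.z]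

/-- The in-cylinder components `φ_θ, φ_z`. -/
def Displacement.inCyl (φ : Displacement) : Fin 2 → ℝ × ℝ → ℝ := ![φ.theta, φ.z]

/-- The von Kármán–Donnell strain tensor
`ε = e(φ_θ, φ_z) + ½ Dφ_ρ ⊗ Dφ_ρ + φ_ρ e_θ ⊗ e_θ`. -/
def strain (φ : Displacement) (x : ℝ × ℝ) : Matrix (Fin 2) (Fin 2) ℝ := fun i j =>
  (weakPartial i (φ.inCyl j) x + weakPartial j (φ.inCyl i) x) / 2
    + 1 / 2 * (weakPartial i φ.rho x * weakPartial j φ.rho x)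
    + (if i = 0 ∧ j = 0 then φ.rho x else 0)

/-- The von Kármán–Donnell energy `E_h(φ) = ∫_Ω |ε|² + h² |D²φ_ρ|² dθ dz`. -/
def energy (h : ℝ) (φ : Displacement) : ℝ≥0∞ :=
  ∫⁻ x, ENNReal.ofReal
    ((∑ i, ∑ j, strain φ x i j ^ 2)
      + h ^ 2 * ∑ i, ∑ j, weakPartial i (weakPartial j φ.rho) x ^ 2) ∂muOmega

/-- The admissible set `A_{λ,ϱ,m}`. -/
def admissible (lam varrho : ℝ) (m : ℝ≥0∞) : Set Displacement :=
  {φ | MemH2Per φ.rho ∧ MemH1Per φ.theta ∧ MemH1Per (fun x => φ.z x + lam * x.2) ∧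
    (∀ᵐ x ∂muOmega, varrho - 1 ≤ φ.rho x) ∧
    ∀ i j, eLpNorm (weakPartial i (φ.comp j)) ∞ muOmega ≤ m}

/-- `φ` minimizes `E_h` over `A_{λ,ϱ,m}`. -/
def IsMinimizer (h lam varrho : ℝ) (m : ℝ≥0∞) (φ : Displacement) : Prop :=
  φ ∈ admissible lam varrho m ∧ ∀ ψ ∈ admissible lam varrho m, energy h φ ≤ energy h ψ

/-- The slope `‖Dφ_ρ‖_{L^∞(Ω)}` of the radial displacement, a number in `[0, ∞]`. -/
def radialSlope (φ : Displacement) : ℝ≥0∞ :=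
  eLpNorm (fun x => Real.sqrt (∑ i, weakPartial i φ.rho x ^ 2)) ∞ muOmega

end VKD

end

noncomputable section

namespace VKD

/-! ### The reference domain and weak derivatives -/

/-! Write δ = ϱ - 1, and let M be the slope of a minimizer. A fast wrinkling is forced because the
minimal energy barely exceeds the bulk value 2πδ².

Upper bound (`exists_competitor`, `exists_wrinkle_width`): one axisymmetric wrinkle of width ℓ and
amplitude √(λℓ) absorbs the whole compression λ at zero axial strain. Up to a numerical factor, its
excess over 2πδ² is δ√(λℓ)ℓ + λℓ² + h²λ/ℓ². Balancing the first and last terms gives ℓ = h^{4/7}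
λ^{1/7} δ^{-2/7}. The hypothesis δ ≥ λ^{1/2} h^{1/4} says exactly that ℓ² ≤ h, so the middle term is
no larger. The excess is thus of order E = h²λ/ℓ².

Lower bound (`exists_energy_lower_bound`, `integral_strain_zero_zero_sq`): because φ_ρ ≥ δ, the hoop
strain costs at least 2πδ² + 2δ‖φ_ρ - δ‖₁. After 2πδ² cancels, each of δ‖φ_ρ - δ‖₁, ‖ε_zz‖₂² and
h²‖∂_z²φ_ρ‖₂² is O(E). The smallness of h means E ≪ λ², so the mean of ε_zz is small compared with
λ; as φ_z + λz is periodic, this forces ‖∂_zφ_ρ‖₂² ≥ 2πλ (`integral_strain_one_one`).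

Conclusion: the interpolation inequality `integral_sq_weakPartial_le` bounds ‖∂_zφ_ρ‖₂² by (M/t)‖φ_ρ
- δ‖₁ + t²‖∂_z²φ_ρ‖₂², up to constants. With t a small multiple of ℓ the bending term is absorbed,
leaving λ ≲ (M/ℓ)(E/δ) = M√(λℓ). Hence M ≳ λ/√(λℓ) = δ^{1/7} h^{-2/7} λ^{3/7}. -/

theorem interior_Omega :
    interior Omega = Ioo 0 (2 * Real.pi) ×ˢ Ioo (-(1 / 2)) (1 / 2) := by
  rw [Omega, interior_prod_eq, interior_Icc, interior_Icc]

theorem Omega_eq_Icc :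
    Omega = Icc ((0 : ℝ), (-(1 / 2) : ℝ)) (2 * Real.pi, 1 / 2) := by
  rw [Omega, Icc_prod_Icc]

theorem isCompact_Omega : IsCompact Omega := isCompact_Icc.prod isCompact_Icc

theorem measurableSet_Omega : MeasurableSet Omega := isCompact_Omega.measurableSet

theorem volume_Omega : volume Omega = ENNReal.ofReal (2 * Real.pi) := by
  rw [Omega, Measure.volume_eq_prod, Measure.prod_prod, Real.volume_Icc, Real.volume_Icc]
  norm_num

instance : IsFiniteMeasure muOmega :=
  ⟨by rw [muOmega, Measure.restrict_apply_univ, volume_Omega]; exact ENNReal.ofReal_lt_top⟩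

theorem integral_const_muOmega (c : ℝ) : ∫ _, c ∂muOmega = 2 * Real.pi * c := by
  rw [integral_const, muOmega, measureReal_restrict_apply_univ, measureReal_def, volume_Omega,
    ENNReal.toReal_ofReal Real.two_pi_pos.le, smul_eq_mul]

theorem muOmega_eq_prod : muOmega =
    (volume.restrict (Icc (0 : ℝ) (2 * Real.pi))).prod
      (volume.restrict (Icc (-(1 / 2) : ℝ) (1 / 2))) := by
  rw [Measure.prod_restrict, ← Measure.volume_eq_prod]; rfl

theorem muOmega_eq_interior : muOmega = volume.restrict (interior Omega) := by
  rw [muOmega, interior_Omega]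
  refine Measure.restrict_congr_set ?_
  rw [Measure.volume_eq_prod]
  exact Measure.set_prod_ae_eq Ioo_ae_eq_Icc.symm Ioo_ae_eq_Icc.symm

theorem integral_muOmega_eq {f : ℝ × ℝ → ℝ} (hf : Integrable f muOmega) :
    ∫ x, f x ∂muOmega =
      ∫ θ in (0 : ℝ)..(2 * Real.pi), ∫ z in (-(1 / 2) : ℝ)..(1 / 2), f (θ, z) := by
  rw [muOmega_eq_prod] at hf ⊢
  rw [integral_prod _ hf, intervalIntegral.integral_of_le Real.two_pi_pos.le,
    ← integral_Icc_eq_integral_Ioc]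
  refine integral_congr_ae (Eventually.of_forall fun θ => ?_)
  simp only
  rw [intervalIntegral.integral_of_le (by norm_num), ← integral_Icc_eq_integral_Ioc]

theorem integrable_of_continuous {f : ℝ × ℝ → ℝ} (hf : Continuous f) : Integrable f muOmega :=
  hf.continuousOn.integrableOn_compact isCompact_Omega

theorem memLp_of_continuous {f : ℝ × ℝ → ℝ} (hf : Continuous f) (p : ℝ≥0∞) :
    MemLp f p muOmega := by
  obtain ⟨C, hC⟩ := isCompact_Omega.exists_bound_of_continuousOn hf.continuousOn
  exact MemLp.of_bound hf.aestronglyMeasurable C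
    ((ae_restrict_iff' measurableSet_Omega).2 (Eventually.of_forall hC))

theorem locallyIntegrableOn_of_integrable {f : ℝ × ℝ → ℝ} (hf : Integrable f muOmega) :
    LocallyIntegrableOn f (interior Omega) := by
  have : IntegrableOn f Omega := hf
  exact (this.mono_set interior_subset).locallyIntegrableOn

theorem integral_mul_congr_left {f f' : ℝ × ℝ → ℝ} (h : f =ᵐ[muOmega] f') (k : ℝ × ℝ → ℝ) :
    ∫ x, f x * k x ∂muOmega = ∫ x, f' x * k x ∂muOmega :=
  integral_congr_ae (h.mono fun x hx => by simp only [hx])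

/-- The du Bois-Reymond lemma. Since `weakPartial` is an arbitrary choice, every computation of it
rests on this uniqueness. -/
theorem IsWeakPartial.ae_eq {i : Fin 2} {f g g' : ℝ × ℝ → ℝ} (h : IsWeakPartial i f g)
    (h' : IsWeakPartial i f g') : g =ᵐ[muOmega] g' := by
  have key := isOpen_interior.ae_eq_zero_of_integral_contDiff_smul_eq_zero (μ := volume)
    (h.2.1.sub h'.2.1) (fun ψ h1 h2 h3 => ?_)
  · rw [muOmega_eq_interior]
    refine (ae_restrict_iff' isOpen_interior.measurableSet).2 ?_
    filter_upwards [key] with x hx hm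
    exact sub_eq_zero.1 (hx hm)
  · have e1 := h.2.2 ψ ⟨h1, h2, h3⟩
    have e2 := h'.2.2 ψ ⟨h1, h2, h3⟩
    have zero : ∀ x ∉ interior Omega, ψ x = 0 := fun x hx =>
      image_eq_zero_of_notMem_tsupport fun hx' => hx (h3 hx')
    have int : ∀ k : ℝ × ℝ → ℝ, LocallyIntegrableOn k (interior Omega) →
        Integrable (fun x => k x * ψ x) muOmega := by
      intro k hk
      have hK : IntegrableOn k (tsupport ψ) := hk.integrableOn_compact_subset h3 h2
      have h4 : IntegrableOn (fun x => k x * ψ x) (tsupport ψ) :=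
        hK.mul_continuousOn h1.continuous.continuousOn h2
      have h5 : Integrable (fun x => k x * ψ x) := by
        refine (integrableOn_iff_integrable_of_support_subset ?_).1 h4
        intro x hx
        exact subset_tsupport _ (right_ne_zero_of_mul hx)
      exact h5.mono_measure Measure.restrict_le_self
    have e3 : ∫ x, (g x * ψ x - g' x * ψ x) ∂muOmega = 0 := by
      rw [integral_sub (int g h.2.1) (int g' h'.2.1)]
      linarith
    rw [muOmega_eq_interior, setIntegral_eq_integral_of_forall_compl_eq_zero] at e3
    · rw [← e3]
      refine integral_congr_ae (Eventually.of_forall fun x => ?_)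
      simp only [smul_eq_mul, Pi.sub_apply]
      ring
    · intro x hx
      simp [zero x hx]

theorem isWeakPartial_weakPartial {i : Fin 2} {f g : ℝ × ℝ → ℝ} (h : IsWeakPartial i f g) :
    IsWeakPartial i f (weakPartial i f) := by
  have H : ∃ g, IsWeakPartial i f g := ⟨g, h⟩
  rw [weakPartial, dif_pos H]
  exact Classical.choose_spec H

theorem weakPartial_ae_eq {i : Fin 2} {f g : ℝ × ℝ → ℝ} (h : IsWeakPartial i f g) :
    weakPartial i f =ᵐ[muOmega] g :=
  (isWeakPartial_weakPartial h).ae_eq h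

theorem IsWeakPartial.congr {i : Fin 2} {f f' g g' : ℝ × ℝ → ℝ} (h : IsWeakPartial i f g)
    (hf : f =ᵐ[muOmega] f') (hg : g =ᵐ[muOmega] g') (hf' : Integrable f' muOmega)
    (hg' : Integrable g' muOmega) : IsWeakPartial i f' g' := by
  refine ⟨locallyIntegrableOn_of_integrable hf', locallyIntegrableOn_of_integrable hg', ?_⟩
  intro ψ hψ
  rw [← integral_mul_congr_left hf, ← integral_mul_congr_left hg]
  exact h.2.2 ψ hψ

theorem MemH1.isWeakPartial {f : ℝ × ℝ → ℝ} (h : MemH1 f) (i : Fin 2) :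
    IsWeakPartial i f (weakPartial i f) :=
  let ⟨_, _, hg⟩ := h.2 i
  isWeakPartial_weakPartial hg

theorem MemH1.memLp_weakPartial {f : ℝ × ℝ → ℝ} (h : MemH1 f) (i : Fin 2) :
    MemLp (weakPartial i f) 2 muOmega :=
  let ⟨_, hg, hw⟩ := h.2 i
  hg.ae_eq (weakPartial_ae_eq hw).symm

theorem MemH1.integrable {f : ℝ × ℝ → ℝ} (h : MemH1 f) : Integrable f muOmega :=
  h.1.integrable (by norm_num)

theorem MemH1.integrable_weakPartial {f : ℝ × ℝ → ℝ} (h : MemH1 f) (i : Fin 2) :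
    Integrable (weakPartial i f) muOmega :=
  (h.memLp_weakPartial i).integrable (by norm_num)

theorem MemH1.weakPartial_congr {f f' : ℝ × ℝ → ℝ} (h : MemH1 f) (hf : f =ᵐ[muOmega] f')
    (i : Fin 2) : weakPartial i f' =ᵐ[muOmega] weakPartial i f :=
  weakPartial_ae_eq ((h.isWeakPartial i).congr hf (ae_eq_refl _) (h.integrable.congr hf)
    (h.integrable_weakPartial i))

theorem MemH1Per.congr {f f' : ℝ × ℝ → ℝ} (h : MemH1Per f) (hf : f =ᵐ[muOmega] f') :
    MemH1Per f' := by
  refine ⟨⟨h.1.1.ae_eq hf, fun i => ⟨weakPartial i f, h.1.memLp_weakPartial i, ?_⟩⟩, ?_⟩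
  · exact (h.1.isWeakPartial i).congr hf (ae_eq_refl _) (h.1.integrable.congr hf)
      (h.1.integrable_weakPartial i)
  · intro i ψ hψ
    rw [← integral_mul_congr_left hf, integral_mul_congr_left (h.1.weakPartial_congr hf i)]
    exact h.2 i ψ hψ

theorem MemH1Per.integral_weakPartial {f : ℝ × ℝ → ℝ} (h : MemH1Per f) (i : Fin 2) :
    ∫ x, weakPartial i f x ∂muOmega = 0 := by
  have := h.2 i (fun _ => 1) ⟨contDiff_const, by simp, by simp⟩
  simpa using this

/-! ### Functions of the axial variable -/

theorem IsTestFunction.eq_zero {ψ : ℝ × ℝ → ℝ} (hψ : IsTestFunction ψ) {x : ℝ × ℝ}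
    (hx : x ∉ interior Omega) : ψ x = 0 :=
  image_eq_zero_of_notMem_tsupport fun hx' => hx (hψ.2.2 hx')

/-- Integration by parts on `Ω` when the boundary terms cancel. -/
theorem integral_mul_fderiv {ψ : ℝ × ℝ → ℝ} (hψ : ContDiff ℝ ∞ ψ) {g g' : ℝ → ℝ}
    (hg : ∀ z, HasDerivAt g (g' z) z) (hg' : Continuous g')
    (h0 : ∀ z, ψ (0, z) = ψ (2 * Real.pi, z))
    (h1 : ∀ θ, g (1 / 2) * ψ (θ, 1 / 2) = g (-(1 / 2)) * ψ (θ, -(1 / 2))) :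
    (∫ x, g x.2 * fderiv ℝ ψ x (basisVec 0) ∂muOmega = 0) ∧
      ∫ x, g x.2 * fderiv ℝ ψ x (basisVec 1) ∂muOmega = -∫ x, g' x.2 * ψ x ∂muOmega := by
  have hgc : Continuous g := continuous_iff_continuousAt.2 fun z => (hg z).continuousAt
  have hψd : ∀ x, HasFDerivAt ψ (fderiv ℝ ψ x) x := fun x =>
    (hψ.differentiable (by simp) x).hasFDerivAt
  have hψc : Continuous fun x => fderiv ℝ ψ x := hψ.continuous_fderiv (by simp)
  have hc : ∀ v : ℝ × ℝ, Continuous fun x => fderiv ℝ ψ x v := fun v =>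
    hψc.clm_apply continuous_const
  have hψ0 := hψ.continuous
  have hG : ∀ x : ℝ × ℝ, HasFDerivAt (fun x : ℝ × ℝ => g x.2)
      (g' x.2 • ContinuousLinearMap.snd ℝ ℝ ℝ) x := fun x =>
    (hg x.2).comp_hasFDerivAt x hasFDerivAt_snd
  have hF : ∀ x : ℝ × ℝ, HasFDerivAt (fun x : ℝ × ℝ => g x.2 * ψ x)
      (g x.2 • fderiv ℝ ψ x + ψ x • (g' x.2 • ContinuousLinearMap.snd ℝ ℝ ℝ)) x := fun x =>
    (hG x).mul (hψd x)
  have hle : ((0 : ℝ), (-(1 / 2) : ℝ)) ≤ (2 * Real.pi, 1 / 2) :=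
    ⟨Real.two_pi_pos.le, by norm_num⟩
  have hFc : Continuous fun x : ℝ × ℝ => g x.2 * ψ x := by fun_prop
  have hb0 : basisVec 0 = (1, 0) := rfl
  have hb1 : basisVec 1 = (0, 1) := rfl
  constructor
  · have := integral_divergence_prod_Icc_of_hasFDerivAt_of_le (fun x : ℝ × ℝ => g x.2 * ψ x)
      (fun _ => 0) _ (fun _ => 0) _ _ hle hFc.continuousOn continuousOn_const
      (fun x _ => hF x) (fun x _ => hasFDerivAt_const _ _) ?_
    · simp only [h0] at this
      rw [← Omega_eq_Icc] at this
      simpa [muOmega, hb0] using this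
    · refine Continuous.integrableOn_Icc ?_
      have := hc (1, 0)
      simp
      fun_prop
  · have := integral_divergence_prod_Icc_of_hasFDerivAt_of_le (fun _ => 0)
      (fun x : ℝ × ℝ => g x.2 * ψ x) (fun _ => 0) _ _ _ hle continuousOn_const hFc.continuousOn
      (fun x _ => hasFDerivAt_const _ _) (fun x _ => hF x) ?_
    · simp only [h1] at this
      rw [← Omega_eq_Icc] at this
      simp only [_root_.zero_apply, _root_.add_apply,
        _root_.smul_apply, ContinuousLinearMap.coe_snd', smul_eq_mul, zero_add,
        mul_one, sub_self, intervalIntegral.integral_zero] at this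
      have hi1 : Integrable (fun x : ℝ × ℝ => g x.2 * fderiv ℝ ψ x (0, 1)) muOmega :=
        integrable_of_continuous ((hgc.comp continuous_snd).mul (hc (0, 1)))
      have hi2 : Integrable (fun x : ℝ × ℝ => g' x.2 * ψ x) muOmega :=
        integrable_of_continuous ((hg'.comp continuous_snd).mul hψ0)
      rw [hb1, ← add_eq_zero_iff_eq_neg, ← integral_add hi1 hi2]
      simpa only [muOmega, mul_comm] using this
    · refine Continuous.integrableOn_Icc ?_
      have := hc (0, 1)
      simp
      fun_prop

/-- The partial derivatives of `(θ, z) ↦ g z`, given the derivative `g'`. -/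
def axialPartial (g' : ℝ → ℝ) : Fin 2 → ℝ × ℝ → ℝ := ![fun _ => 0, fun x => g' x.2]

theorem continuous_axialPartial {g' : ℝ → ℝ} (hg' : Continuous g') (i : Fin 2) :
    Continuous (axialPartial g' i) := by
  fin_cases i
  · exact continuous_const
  · exact hg'.comp continuous_snd

theorem isWeakPartial_axial {g g' : ℝ → ℝ} (hg : ∀ z, HasDerivAt g (g' z) z)
    (hg' : Continuous g') (i : Fin 2) :
    IsWeakPartial i (fun x => g x.2) (axialPartial g' i) := by
  have hgc : Continuous g := continuous_iff_continuousAt.2 fun z => (hg z).continuousAt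
  refine ⟨locallyIntegrableOn_of_integrable (integrable_of_continuous (hgc.comp continuous_snd)),
    locallyIntegrableOn_of_integrable (integrable_of_continuous (continuous_axialPartial hg' i)),
    fun ψ hψ => ?_⟩
  have key := integral_mul_fderiv hψ.1 hg hg'
    (fun z => by rw [hψ.eq_zero, hψ.eq_zero] <;> simp [interior_Omega])
    (fun θ => by rw [hψ.eq_zero, hψ.eq_zero] <;> simp [interior_Omega])
  fin_cases i
  · simpa [axialPartial] using key.1
  · simpa [axialPartial] using key.2

theorem memH1Per_axial {g g' : ℝ → ℝ} (hg : ∀ z, HasDerivAt g (g' z) z)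
    (hg' : Continuous g') (hper : g (1 / 2) = g (-(1 / 2))) :
    MemH1Per fun x => g x.2 := by
  have hgc : Continuous g := continuous_iff_continuousAt.2 fun z => (hg z).continuousAt
  refine ⟨⟨memLp_of_continuous (hgc.comp continuous_snd) 2, fun i =>
    ⟨_, memLp_of_continuous (continuous_axialPartial hg' i) 2, isWeakPartial_axial hg hg' i⟩⟩, ?_⟩
  intro i ψ hψ
  have key := integral_mul_fderiv hψ.1 hg hg'
    (fun z => by rw [← hψ.2.1 0 z, zero_add])
    (fun θ => by rw [hper, ← hψ.2.2 θ (-(1 / 2))]; norm_num)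
  rw [integral_mul_congr_left (weakPartial_ae_eq (isWeakPartial_axial hg hg' i))]
  fin_cases i
  · simpa [axialPartial] using key.1
  · simpa [axialPartial] using key.2

theorem memH2Per_axial {g g' g'' : ℝ → ℝ} (hg : ∀ z, HasDerivAt g (g' z) z)
    (hg' : ∀ z, HasDerivAt g' (g'' z) z) (hg'' : Continuous g'')
    (hper : g (1 / 2) = g (-(1 / 2))) (hper' : g' (1 / 2) = g' (-(1 / 2))) :
    MemH2Per fun x => g x.2 := by
  have hgc : Continuous g' := continuous_iff_continuousAt.2 fun z => (hg' z).continuousAt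
  refine ⟨memH1Per_axial hg hgc hper, fun i => ?_⟩
  refine MemH1Per.congr ?_ (weakPartial_ae_eq (isWeakPartial_axial hg hgc i)).symm
  fin_cases i
  · exact memH1Per_axial (g := fun _ => 0) (g' := fun _ => 0) (fun z => hasDerivAt_const z 0)
      continuous_const rfl
  · exact memH1Per_axial hg' hg'' hper'

/-! ### Averages of periodic test functions in the axial direction -/

/-- The integral is a convolution in r, evaluated at 0, of k restricted to (0, t] with a function
depending on the parameter x. The cutoff χ equals 1 on [-t, t], so it changes nothing, but supplies
the compact support needed to differentiate in x. -/
theorem contDiff_integral_shift {ψ : ℝ × ℝ → ℝ} (hψ : ContDiff ℝ ∞ ψ) {k : ℝ → ℝ}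
    (hk : Continuous k) {t : ℝ} (ht : 0 < t) :
    ContDiff ℝ ∞ fun x : ℝ × ℝ => ∫ r in (0 : ℝ)..t, k r * ψ (x.1, x.2 - r) := by
  let χ : ContDiffBump (0 : ℝ) := ⟨t, 2 * t, ht, by linarith⟩
  have hf : LocallyIntegrable ((Ioc 0 t).indicator k) volume :=
    (integrable_indicator_iff measurableSet_Ioc).2
      (hk.integrableOn_Icc.mono_set Ioc_subset_Icc_self) |>.locallyIntegrable
  have hχ : ContDiff ℝ ∞ χ := χ.contDiff
  have key := contDiffOn_convolution_right_with_param_comp (𝕜 := ℝ) (n := (⊤ : ℕ∞)) (μ := volume)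
    (ContinuousLinearMap.mul ℝ ℝ) (s := (univ : Set (ℝ × ℝ))) (v := fun _ => (0 : ℝ))
    contDiffOn_const (g := fun (x : ℝ × ℝ) (r : ℝ) => χ r * ψ (x.1, x.2 + r))
    (k := Metric.closedBall 0 (2 * t)) isOpen_univ (isCompact_closedBall _ _) ?_ hf ?_
  · rw [contDiffOn_univ] at key
    convert key using 2 with x
    rw [intervalIntegral.integral_of_le ht.le, convolution_def,
      ← integral_indicator measurableSet_Ioc]
    refine integral_congr_ae (Eventually.of_forall fun r => ?_)
    by_cases hr : r ∈ Ioc 0 t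
    · have h1 : χ (0 - r) = 1 := χ.one_of_mem_closedBall (by
        simp [χ, abs_of_pos hr.1, hr.2])
      simp [hr, sub_eq_add_neg] at h1 ⊢
      simp [h1]
    · simp [hr]
  · intro x r _ hr
    have : χ r = 0 := by
      by_contra hne
      have hs : r ∈ Function.support χ := hne
      rw [χ.support_eq] at hs
      exact hr (Metric.ball_subset_closedBall hs)
    simp [this]
  · have : ContDiff ℝ ∞ fun y : (ℝ × ℝ) × ℝ => χ y.2 * ψ (y.1.1, y.1.2 + y.2) :=
      (hχ.comp contDiff_snd).mul (hψ.comp (by fun_prop))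
    exact this.contDiffOn

theorem hasDerivAt_integral_shift {q : ℝ → ℝ} (hq : Continuous q) (t z : ℝ) :
    HasDerivAt (fun z => ∫ r in (0 : ℝ)..t, q (z - r)) (q z - q (z - t)) z := by
  have hP : ∀ z, HasDerivAt (fun z => ∫ s in (0 : ℝ)..z, q s) (q z) z := fun z =>
    intervalIntegral.integral_hasDerivAt_right (hq.intervalIntegrable _ _)
      (hq.stronglyMeasurableAtFilter _ _) hq.continuousAt
  have h2 : HasDerivAt (fun z => ∫ s in (0 : ℝ)..(z - t), q s) (q (z - t)) z := by
    simpa using! (hP (z - t)).comp z ((hasDerivAt_id z).sub_const t)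
  refine ((hP z).sub h2).congr_of_eventuallyEq (Eventually.of_forall fun y => ?_)
  simp only [Pi.sub_apply]
  rw [intervalIntegral.integral_comp_sub_left, sub_zero, ← intervalIntegral.integral_interval_sub_left
    (hq.intervalIntegrable _ _) (hq.intervalIntegrable _ _)]

theorem hasDerivAt_integral_weighted_shift {q : ℝ → ℝ} (hq : Continuous q) (t z : ℝ) :
    HasDerivAt (fun z => ∫ r in (0 : ℝ)..t, (t - r) * q (z - r))
      (t * q z - ∫ r in (0 : ℝ)..t, q (z - r)) z := by
  have h1 := hasDerivAt_integral_shift hq t z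
  -- Splitting t - r = (t - z) + (z - r) removes the weight: both pieces are unweighted shift
  -- integrals, of q and of s ↦ s q(s).
  have h2 := hasDerivAt_integral_shift (q := fun s => s * q s) (by fun_prop) t z
  have h3 := (((hasDerivAt_id z).const_sub t).mul h1).add h2
  simp only [id] at h3
  refine (h3.congr_deriv (by ring)).congr_of_eventuallyEq (Eventually.of_forall fun y => ?_)
  · simp only [Pi.add_apply, Pi.mul_apply]
    rw [← intervalIntegral.integral_const_mul, ← intervalIntegral.integral_add
      (Continuous.intervalIntegrable (by fun_prop) _ _)
      (Continuous.intervalIntegrable (by fun_prop) _ _)]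
    refine intervalIntegral.integral_congr fun r _ => ?_
    ring

theorem fderiv_basisVec_one {f : ℝ × ℝ → ℝ} (hf : ContDiff ℝ ∞ f) {x : ℝ × ℝ} {d : ℝ}
    (hd : HasDerivAt (fun z => f (x.1, z)) d x.2) : fderiv ℝ f x (basisVec 1) = d := by
  have h1 : HasFDerivAt f (fderiv ℝ f x) (x.1, x.2) :=
    (hf.differentiable (by simp) x).hasFDerivAt
  have h2 : HasDerivAt (fun z : ℝ => (x.1, z)) ((0, 1) : ℝ × ℝ) x.2 :=
    (hasDerivAt_const _ _).prodMk (hasDerivAt_id _)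
  exact (h1.comp_hasDerivAt x.2 h2).unique hd

theorem IsPeriodicTestFunction.shift {ψ : ℝ × ℝ → ℝ} (hψ : IsPeriodicTestFunction ψ) {k : ℝ → ℝ}
    (hk : Continuous k) {t : ℝ} (ht : 0 < t) :
    IsPeriodicTestFunction fun x => ∫ r in (0 : ℝ)..t, k r * ψ (x.1, x.2 - r) := by
  refine ⟨contDiff_integral_shift hψ.1 hk ht, fun θ z => by simp only [hψ.2.1], fun θ z => ?_⟩
  refine intervalIntegral.integral_congr fun r _ => ?_
  simp only
  rw [← hψ.2.2 θ (z - r)]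
  ring_nf

theorem IsPeriodicTestFunction.integral_fderiv {ψ : ℝ × ℝ → ℝ} (hψ : IsPeriodicTestFunction ψ) :
    ∫ x, fderiv ℝ ψ x (basisVec 1) ∂muOmega = 0 := by
  have := (integral_mul_fderiv hψ.1 (g := fun _ => 1) (g' := fun _ => 0)
    (fun z => hasDerivAt_const z 1) continuous_const
    (fun z => by rw [← hψ.2.1 0 z, zero_add])
    (fun θ => by rw [← hψ.2.2 θ (-(1 / 2))]; norm_num)).2
  simpa using this

theorem integral_axial_shift {f : ℝ × ℝ → ℝ} (hf : Continuous f)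
    (hper : ∀ θ z, f (θ, z + 1) = f (θ, z)) (r : ℝ) :
    ∫ x, f (x.1, x.2 - r) ∂muOmega = ∫ x, f x ∂muOmega := by
  rw [integral_muOmega_eq (integrable_of_continuous (by fun_prop)),
    integral_muOmega_eq (integrable_of_continuous hf)]
  refine intervalIntegral.integral_congr fun θ _ => ?_
  have hp : Function.Periodic (fun z => f (θ, z)) 1 := fun z => hper θ z
  have h := hp.intervalIntegral_add_eq (-(1 / 2) - r) (-(1 / 2))
  simp only
  rw [intervalIntegral.integral_comp_sub_right (fun z => f (θ, z))]
  convert h using 2 <;> ring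

theorem integral_integral_shift_sq {ψ : ℝ × ℝ → ℝ} (hψ : IsPeriodicTestFunction ψ) {t : ℝ}
    (ht : 0 < t) :
    Integrable (fun x => ∫ r in (0 : ℝ)..t, ψ (x.1, x.2 - r) ^ 2) muOmega ∧
    ∫ x, (∫ r in (0 : ℝ)..t, ψ (x.1, x.2 - r) ^ 2) ∂muOmega = t * ∫ x, ψ x ^ 2 ∂muOmega := by
  have hc := hψ.1.continuous
  constructor
  · refine integrable_of_continuous ?_
    have := (contDiff_integral_shift (hψ.1.pow 2) continuous_const (k := fun _ => 1) ht).continuous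
    simpa using this
  · have hint : Integrable (Function.uncurry fun (x : ℝ × ℝ) (r : ℝ) => ψ (x.1, x.2 - r) ^ 2)
        (muOmega.prod (volume.restrict (Ioc 0 t))) := by
      rw [muOmega, Measure.prod_restrict, ← Measure.volume_eq_prod]
      refine IntegrableOn.mono_set (t := Omega ×ˢ Icc 0 t) ?_
        (prod_mono_right Ioc_subset_Icc_self)
      refine ContinuousOn.integrableOn_compact (isCompact_Omega.prod isCompact_Icc) ?_
      exact Continuous.continuousOn (by simp only [Function.uncurry_def]; fun_prop)
    simp only [intervalIntegral.integral_of_le ht.le]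
    rw [integral_integral_swap hint]
    have : ∀ r, ∫ x, ψ (x.1, x.2 - r) ^ 2 ∂muOmega = ∫ x, ψ x ^ 2 ∂muOmega := fun r =>
      integral_axial_shift (f := fun x => ψ x ^ 2) (by fun_prop)
        (fun θ z => by simp only [hψ.2.2]) r
    simp only [this]
    rw [setIntegral_const]
    simp [ht.le]

/-- Young's inequality |a| t |q| ≤ (t²a² + q²)/2 under the integral over r in [0, t]. The weight ½
on q² lets that term be absorbed later. -/
theorem abs_mul_weighted_shift_le {q : ℝ → ℝ} (hq : Continuous q) {t : ℝ} (ht : 0 < t) (a z : ℝ) :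
    |a * ∫ r in (0 : ℝ)..t, (t - r) * q (z - r)| ≤
      t ^ 3 / 2 * a ^ 2 + 1 / 2 * ∫ r in (0 : ℝ)..t, q (z - r) ^ 2 := by
  have h0 : t ^ 3 / 2 * a ^ 2 + 1 / 2 * ∫ r in (0 : ℝ)..t, q (z - r) ^ 2 =
      ∫ r in (0 : ℝ)..t, (t ^ 2 / 2 * a ^ 2 + 1 / 2 * q (z - r) ^ 2) := by
    rw [intervalIntegral.integral_add (Continuous.intervalIntegrable (by fun_prop) _ _)
      (Continuous.intervalIntegrable (by fun_prop) _ _), intervalIntegral.integral_const,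
      intervalIntegral.integral_const_mul, smul_eq_mul]
    ring
  rw [h0, ← intervalIntegral.integral_const_mul]
  refine (intervalIntegral.abs_integral_le_integral_abs ht.le).trans ?_
  refine intervalIntegral.integral_mono_on ht.le
    (Continuous.intervalIntegrable (by fun_prop) _ _)
    (Continuous.intervalIntegrable (by fun_prop) _ _) fun r hr => ?_
  have h1 : |t - r| ≤ t := by
    rw [abs_of_nonneg (by linarith [hr.2])]; linarith [hr.1]
  rw [abs_mul, abs_mul]
  have h2 : |a| * (|t - r| * |q (z - r)|) ≤ |a| * (t * |q (z - r)|) := by gcongr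
  nlinarith [sq_nonneg (t * |a| - |q (z - r)|), sq_abs a, sq_abs (q (z - r))]

/-- The interpolation inequality in weak form, tested against a bounded smooth function. -/
theorem integral_mul_periodic_le {w ψ : ℝ × ℝ → ℝ} (hw : MemH1Per w)
    (hv : MemH1Per (weakPartial 1 w)) (hψ : IsPeriodicTestFunction ψ) {M t : ℝ} (ht : 0 < t)
    (hM : ∀ x, |ψ x| ≤ M) (c : ℝ) :
    ∫ x, weakPartial 1 w x * ψ x ∂muOmega ≤
      2 * M / t * ∫ x, |w x - c| ∂muOmega +
        t ^ 2 / 2 * ∫ x, weakPartial 1 (weakPartial 1 w) x ^ 2 ∂muOmega +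
        1 / 2 * ∫ x, ψ x ^ 2 ∂muOmega := by
  have hc := hψ.1.continuous
  have hI := hψ.shift (k := fun _ => 1) continuous_const ht
  have hΦ := hψ.shift (k := fun r => t - r) (by fun_prop) ht
  simp only [one_mul] at hI
  -- Averages of ψ replace a pointwise Taylor expansion of w. Since tψ = I + ∂_zΦ and ∂_zI is a
  -- difference of ψ, the pairing with ∂_z w splits into one with w and one with ∂_z² w, using only
  -- the weak periodic integration by parts.
  set I : ℝ × ℝ → ℝ := fun x => ∫ r in (0 : ℝ)..t, ψ (x.1, x.2 - r) with hIdef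
  set Φ : ℝ × ℝ → ℝ := fun x => ∫ r in (0 : ℝ)..t, (t - r) * ψ (x.1, x.2 - r) with hΦdef
  have dI : ∀ x, fderiv ℝ I x (basisVec 1) = ψ x - ψ (x.1, x.2 - t) := fun x =>
    fderiv_basisVec_one hI.1
      (hasDerivAt_integral_shift (q := fun z => ψ (x.1, z)) (by fun_prop) t x.2)
  have dΦ : ∀ x, fderiv ℝ Φ x (basisVec 1) = t * ψ x - I x := fun x =>
    fderiv_basisVec_one hΦ.1
      (hasDerivAt_integral_weighted_shift (q := fun z => ψ (x.1, z)) (by fun_prop) t x.2)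
  have e1 := hw.2 1 I hI
  have e2 := hv.2 1 Φ hΦ
  have e3 := hI.integral_fderiv
  simp only [dI] at e1 e3
  simp only [dΦ] at e2
  set v := weakPartial 1 w
  set u := weakPartial 1 v
  have hv2 : MemLp v 2 muOmega := hv.1.1
  have hu2 : MemLp u 2 muOmega := hv.1.memLp_weakPartial 1
  have hcI := hI.1.continuous
  have hcΦ := hΦ.1.continuous
  have i1 : Integrable (fun x => v x * ψ x) muOmega :=
    hv2.integrable_mul (memLp_of_continuous hc 2)
  have i2 : Integrable (fun x => v x * I x) muOmega :=
    hv2.integrable_mul (memLp_of_continuous hcI 2)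
  have i3 : Integrable (fun x => u x * Φ x) muOmega :=
    hu2.integrable_mul (memLp_of_continuous hcΦ 2)
  have hcd : Continuous fun x : ℝ × ℝ => ψ x - ψ (x.1, x.2 - t) := by fun_prop
  have i4 : Integrable (fun x => w x * (ψ x - ψ (x.1, x.2 - t))) muOmega :=
    hw.1.1.integrable_mul (memLp_of_continuous hcd 2)
  have i5 : Integrable (fun x => |w x - c|) muOmega :=
    (hw.1.integrable.sub (integrable_const c)).abs
  obtain ⟨i6, e6⟩ := integral_integral_shift_sq hψ ht
  have i7 : Integrable (fun x => u x ^ 2) muOmega := hu2.integrable_sq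
  have b1 : t * ∫ x, v x * ψ x ∂muOmega =
      -∫ x, w x * (ψ x - ψ (x.1, x.2 - t)) ∂muOmega - ∫ x, u x * Φ x ∂muOmega := by
    rw [e1, neg_neg]
    have : ∫ x, v x * (t * ψ x - I x) ∂muOmega =
        t * ∫ x, v x * ψ x ∂muOmega - ∫ x, v x * I x ∂muOmega := by
      rw [← integral_const_mul, ← integral_sub (i1.const_mul t) i2]
      exact integral_congr_ae (Eventually.of_forall fun x => by simp only; ring)
    linarith
  -- The constant c costs nothing because ∂_zI has zero mean.
  have b2 : -∫ x, w x * (ψ x - ψ (x.1, x.2 - t)) ∂muOmega ≤ 2 * M * ∫ x, |w x - c| ∂muOmega := by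
    have : ∫ x, (c - w x) * (ψ x - ψ (x.1, x.2 - t)) ∂muOmega =
        -∫ x, w x * (ψ x - ψ (x.1, x.2 - t)) ∂muOmega := by
      have h0 : ∫ x, c * (ψ x - ψ (x.1, x.2 - t)) ∂muOmega = 0 := by
        rw [integral_const_mul, e3, mul_zero]
      rw [← zero_sub, ← h0, ← integral_sub ((integrable_of_continuous hcd).const_mul c) i4]
      exact integral_congr_ae (Eventually.of_forall fun x => by simp only; ring)
    rw [← this, ← integral_const_mul]
    have i8 : Integrable (fun x => (c - w x) * (ψ x - ψ (x.1, x.2 - t))) muOmega :=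
      (((memLp_const c).sub hw.1.1).integrable_mul (memLp_of_continuous hcd 2))
    refine integral_mono i8 (i5.const_mul _) fun x => (le_abs_self _).trans ?_
    simp only
    rw [abs_mul, abs_sub_comm, mul_comm]
    gcongr
    exact (abs_sub _ _).trans (by linarith [hM x, hM (x.1, x.2 - t)])
  have b3 : -∫ x, u x * Φ x ∂muOmega ≤
      t ^ 3 / 2 * ∫ x, u x ^ 2 ∂muOmega + 1 / 2 * (t * ∫ x, ψ x ^ 2 ∂muOmega) := by
    rw [← integral_neg, ← e6, ← integral_const_mul, ← integral_const_mul,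
      ← integral_add (i7.const_mul _) (i6.const_mul _)]
    refine integral_mono i3.neg ((i7.const_mul _).add (i6.const_mul _)) fun x => ?_
    exact (neg_le_abs _).trans
      (abs_mul_weighted_shift_le (q := fun z => ψ (x.1, z)) (by fun_prop) ht (u x) x.2)
  refine le_of_mul_le_mul_left ?_ ht
  rw [b1]
  have : t * (2 * M / t * ∫ x, |w x - c| ∂muOmega + t ^ 2 / 2 * ∫ x, u x ^ 2 ∂muOmega +
      1 / 2 * ∫ x, ψ x ^ 2 ∂muOmega) = 2 * M * ∫ x, |w x - c| ∂muOmega +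
      (t ^ 3 / 2 * ∫ x, u x ^ 2 ∂muOmega + 1 / 2 * (t * ∫ x, ψ x ^ 2 ∂muOmega)) := by
    field_simp
    ring
  rw [this]
  linarith

/-! ### Periodic smooth approximation and the interpolation inequality -/

/-- The point of `Ω` congruent to `x` modulo the period lattice. -/
def periodicPoint (x : ℝ × ℝ) : ℝ × ℝ :=
  (2 * Real.pi * Int.fract (x.1 / (2 * Real.pi)), Int.fract (x.2 + 1 / 2) - 1 / 2)

theorem measurable_periodicPoint : Measurable periodicPoint :=
  ((measurable_fract.comp (measurable_fst.div_const _)).const_mul _).prodMk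
    ((measurable_fract.comp (measurable_snd.add_const _)).sub_const _)

theorem periodicPoint_add_left (x : ℝ × ℝ) :
    periodicPoint (x + (2 * Real.pi, 0)) = periodicPoint x := by
  have h : (x.1 + 2 * Real.pi) / (2 * Real.pi) = x.1 / (2 * Real.pi) + 1 := by
    field_simp
  simp [periodicPoint, h]

theorem periodicPoint_add_right (x : ℝ × ℝ) :
    periodicPoint (x + (0, 1)) = periodicPoint x := by
  have h : x.2 + 1 + 1 / 2 = x.2 + 1 / 2 + 1 := by ring
  simp only [periodicPoint, Prod.fst_add, Prod.snd_add, add_zero, h, Int.fract_add_one]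

theorem periodicPoint_of_mem {x : ℝ × ℝ} (hx : x ∈ interior Omega) : periodicPoint x = x := by
  rw [interior_Omega] at hx
  obtain ⟨⟨h1, h2⟩, h3, h4⟩ := hx
  have e1 : Int.fract (x.1 / (2 * Real.pi)) = x.1 / (2 * Real.pi) :=
    Int.fract_eq_self.2 ⟨(div_pos h1 Real.two_pi_pos).le, (div_lt_one Real.two_pi_pos).2 h2⟩
  have e2 : Int.fract (x.2 + 1 / 2) = x.2 + 1 / 2 :=
    Int.fract_eq_self.2 ⟨by linarith, by linarith⟩
  ext
  · simp only [periodicPoint, e1]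
    field_simp
  · simp only [periodicPoint, e2]
    ring

/-- Mollify the truncated periodic extension of v: convolution preserves both the periods and the
bound, and Lebesgue differentiation gives convergence almost everywhere. -/
theorem exists_periodic_approx {v : ℝ × ℝ → ℝ} (hv : AEStronglyMeasurable v muOmega) {M : ℝ}
    (hM : ∀ᵐ x ∂muOmega, |v x| ≤ M) :
    ∃ ψ : ℕ → ℝ × ℝ → ℝ, (∀ n, IsPeriodicTestFunction (ψ n)) ∧ (∀ n x, |ψ n x| ≤ |M|) ∧
      ∀ᵐ x ∂muOmega, Tendsto (fun n => ψ n x) atTop (𝓝 (v x)) := by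
  let f : ℝ × ℝ → ℝ := fun x => max (-|M|) (min |M| (hv.mk v (periodicPoint x)))
  have hfm : Measurable f :=
    measurable_const.max (measurable_const.min
      (hv.stronglyMeasurable_mk.measurable.comp measurable_periodicPoint))
  have hfb : ∀ x, |f x| ≤ |M| := fun x =>
    abs_le.2 ⟨le_max_left _ _, max_le (by linarith [abs_nonneg M]) (min_le_left _ _)⟩
  have hfl : LocallyIntegrable f volume :=
    (locallyIntegrable_const |M|).mono hfm.aestronglyMeasurable
      (Eventually.of_forall fun x => by
        rw [Real.norm_eq_abs, Real.norm_eq_abs, abs_abs]; exact hfb x)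
  have hf1 : ∀ x, f (x + (2 * Real.pi, 0)) = f x := fun x => by
    simp only [f, periodicPoint_add_left]
  have hf2 : ∀ x, f (x + (0, 1)) = f x := fun x => by
    simp only [f, periodicPoint_add_right]
  have hfv : ∀ᵐ x ∂muOmega, f x = v x := by
    have hi : ∀ᵐ x ∂muOmega, x ∈ interior Omega := by
      rw [muOmega_eq_interior]
      exact ae_restrict_mem isOpen_interior.measurableSet
    filter_upwards [hi, hM, hv.ae_eq_mk] with x h1 h2 h3
    have h4 := abs_le.1 (h2.trans (le_abs_self M))
    simp only [f, periodicPoint_of_mem h1, ← h3, min_eq_right h4.2, max_eq_right h4.1]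
  let φ : ℕ → ContDiffBump (0 : ℝ × ℝ) := fun n =>
    ⟨1 / ((n : ℝ) + 1), 2 * (1 / ((n : ℝ) + 1)), by positivity, by
      have : 0 < 1 / ((n : ℝ) + 1) := by positivity
      linarith⟩
  refine ⟨fun n => convolution ((φ n).normed volume) f (ContinuousLinearMap.lsmul ℝ ℝ) volume,
    fun n => ⟨?_, ?_, ?_⟩, fun n x => ?_, ?_⟩
  · exact (φ n).hasCompactSupport_normed.contDiff_convolution_left _ (φ n).contDiff_normed hfl
  · intro θ z
    refine integral_congr_ae (Eventually.of_forall fun y => ?_)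
    have : ((θ + 2 * Real.pi, z) : ℝ × ℝ) - y = ((θ, z) - y) + (2 * Real.pi, 0) := by
      ext <;> simp; ring
    simp only [this, hf1]
  · intro θ z
    refine integral_congr_ae (Eventually.of_forall fun y => ?_)
    have : ((θ, z + 1) : ℝ × ℝ) - y = ((θ, z) - y) + (0, 1) := by
      ext <;> simp; ring
    simp only [this, hf2]
  · beta_reduce
    rw [convolution_def, ← Real.norm_eq_abs]
    have hi := ((φ n).integrable_normed (μ := volume)).mul_const |M|
    refine (norm_integral_le_of_norm_le hi (Eventually.of_forall fun y => ?_)).trans ?_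
    · rw [ContinuousLinearMap.lsmul_apply, smul_eq_mul, norm_mul, Real.norm_eq_abs,
        Real.norm_eq_abs, abs_of_nonneg ((φ n).nonneg_normed y)]
      exact mul_le_mul_of_nonneg_left (hfb _) ((φ n).nonneg_normed y)
    · rw [integral_mul_const, (φ n).integral_normed, one_mul]
  · have key := ContDiffBump.ae_convolution_tendsto_right_of_locallyIntegrable (μ := volume)
      (φ := φ) (l := atTop) (K := 2) ?_ (Eventually.of_forall fun n => le_refl _) hfl
    · filter_upwards [hfv, ae_restrict_of_ae key] with x h1 h2
      rwa [← h1]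
    · simpa [φ] using (tendsto_one_div_add_atTop_nhds_zero_nat (𝕜 := ℝ)).const_mul 2

/-- Gagliardo–Nirenberg type interpolation in the axial direction, with a free length scale `t`. -/
theorem integral_sq_weakPartial_le {w : ℝ × ℝ → ℝ} (hw : MemH1Per w)
    (hv : MemH1Per (weakPartial 1 w)) {M t : ℝ} (ht : 0 < t) (hM0 : 0 ≤ M)
    (hM : ∀ᵐ x ∂muOmega, |weakPartial 1 w x| ≤ M) (c : ℝ) :
    1 / 2 * ∫ x, weakPartial 1 w x ^ 2 ∂muOmega ≤
      2 * M / t * ∫ x, |w x - c| ∂muOmega +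
        t ^ 2 / 2 * ∫ x, weakPartial 1 (weakPartial 1 w) x ^ 2 ∂muOmega := by
  have hvm := hv.1.1.aestronglyMeasurable
  obtain ⟨ψ, h1, h2, h3⟩ := exists_periodic_approx hvm hM
  rw [abs_of_nonneg hM0] at h2
  have hψm : ∀ n, AEStronglyMeasurable (ψ n) muOmega := fun n =>
    (h1 n).1.continuous.aestronglyMeasurable
  -- The test functions converge to ∂_z w itself under the common bound M, so both the pairing and
  -- ∫ψ² tend to ∫(∂_z w)²; half of it is then absorbed on the left.
  have l1 : Tendsto (fun n => ∫ x, weakPartial 1 w x * ψ n x ∂muOmega) atTop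
      (𝓝 (∫ x, weakPartial 1 w x ^ 2 ∂muOmega)) := by
    refine tendsto_integral_of_dominated_convergence (fun _ => M * M)
      (fun n => hvm.mul (hψm n)) (integrable_const _) (fun n => ?_) ?_
    · filter_upwards [hM] with x hx
      rw [norm_mul]
      exact mul_le_mul hx (h2 n x) (norm_nonneg _) hM0
    · filter_upwards [h3] with x hx
      rw [sq]
      exact hx.const_mul _
  have l2 : Tendsto (fun n => ∫ x, ψ n x ^ 2 ∂muOmega) atTop
      (𝓝 (∫ x, weakPartial 1 w x ^ 2 ∂muOmega)) := by
    refine tendsto_integral_of_dominated_convergence (fun _ => M ^ 2)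
      (fun n => (hψm n).pow 2) (integrable_const _) (fun n => ?_) ?_
    · refine Eventually.of_forall fun x => ?_
      rw [norm_pow]
      exact pow_le_pow_left₀ (norm_nonneg _) (h2 n x) 2
    · filter_upwards [h3] with x hx
      exact hx.pow 2
  have := le_of_tendsto_of_tendsto' l1 (tendsto_const_nhds.add (l2.const_mul (1 / 2))) fun n =>
    integral_mul_periodic_le hw hv (h1 n) ht (h2 n) c
  linarith

/-! ### Axisymmetric competitors -/

theorem weakPartial_weakPartial_axial {g g' g'' : ℝ → ℝ} (hg : ∀ z, HasDerivAt g (g' z) z)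
    (hg' : ∀ z, HasDerivAt g' (g'' z) z) (hg'' : Continuous g'')
    (hper' : g' (1 / 2) = g' (-(1 / 2))) (i j : Fin 2) :
    weakPartial i (weakPartial j fun x => g x.2) =ᵐ[muOmega]
      fun x => if i = 1 ∧ j = 1 then g'' x.2 else 0 := by
  have hgc : Continuous g' := continuous_iff_continuousAt.2 fun z => (hg' z).continuousAt
  have e := (weakPartial_ae_eq (isWeakPartial_axial hg hgc j)).symm
  fin_cases j
  · have hm : MemH1Per (axialPartial g' 0) :=
      memH1Per_axial (g := fun _ => 0) (g' := fun _ => 0) (fun z => hasDerivAt_const z 0)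
        continuous_const rfl
    refine (hm.1.weakPartial_congr e i).trans ?_
    refine (weakPartial_ae_eq (isWeakPartial_axial (g := fun _ => 0) (g' := fun _ => 0)
      (fun z => hasDerivAt_const z 0) continuous_const i)).trans (Eventually.of_forall fun x => ?_)
    fin_cases i <;> simp [axialPartial]
  · have hm : MemH1Per (axialPartial g' 1) := memH1Per_axial hg' hg'' hper'
    refine (hm.1.weakPartial_congr e i).trans ?_
    refine (weakPartial_ae_eq (isWeakPartial_axial hg' hg'' i)).trans
      (Eventually.of_forall fun x => ?_)
    fin_cases i <;> simp [axialPartial]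

/-- The choice ζ' = -½ r'² annihilates the axial strain, so only the hoop strain r and the bending
survive. -/
theorem energy_axial {r r' r'' ζ : ℝ → ℝ} (hr : ∀ z, HasDerivAt r (r' z) z)
    (hr' : ∀ z, HasDerivAt r' (r'' z) z) (hr'' : Continuous r'')
    (hζ : ∀ z, HasDerivAt ζ (-(1 / 2) * r' z ^ 2) z)
    (hper' : r' (1 / 2) = r' (-(1 / 2))) (h : ℝ) :
    energy h ⟨fun x => r x.2, fun _ => 0, fun x => ζ x.2⟩ =
      ENNReal.ofReal (2 * Real.pi * ∫ z in (-(1 / 2) : ℝ)..(1 / 2),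
        (r z ^ 2 + h ^ 2 * r'' z ^ 2)) := by
  have hrc : Continuous r := continuous_iff_continuousAt.2 fun z => (hr z).continuousAt
  have hrc' : Continuous r' := continuous_iff_continuousAt.2 fun z => (hr' z).continuousAt
  have hcont : Continuous fun x : ℝ × ℝ => r x.2 ^ 2 + h ^ 2 * r'' x.2 ^ 2 := by fun_prop
  have hint := integrable_of_continuous hcont
  have e1 : ∀ i, _ := fun i => weakPartial_ae_eq (isWeakPartial_axial hr hrc' i)
  have e2 : ∀ i, weakPartial i (fun _ : ℝ × ℝ => (0 : ℝ)) =ᵐ[muOmega]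
      axialPartial (fun _ => 0) i := fun i =>
    weakPartial_ae_eq (isWeakPartial_axial (g := fun _ => 0) (g' := fun _ => 0)
      (fun z => hasDerivAt_const z 0) continuous_const i)
  have e3 : ∀ i, _ := fun i => weakPartial_ae_eq (isWeakPartial_axial hζ (by fun_prop) i)
  have e4 : ∀ i j, _ := fun i j => weakPartial_weakPartial_axial hr hr' hr'' hper' i j
  have hcongr : energy h ⟨fun x => r x.2, fun _ => 0, fun x => ζ x.2⟩ =
      ∫⁻ x, ENNReal.ofReal (r x.2 ^ 2 + h ^ 2 * r'' x.2 ^ 2) ∂muOmega := by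
    refine lintegral_congr_ae ?_
    filter_upwards [e1 0, e1 1, e2 0, e2 1, e3 0, e3 1, e4 0 0, e4 0 1, e4 1 0, e4 1 1]
      with x a0 a1 b0 b1 c0 c1 d00 d01 d10 d11
    congr 1
    simp only [strain, Displacement.inCyl, Fin.sum_univ_two, Matrix.cons_val_zero,
      Matrix.cons_val_one, a0, a1, b0, b1, c0, c1, d00, d01, d10, d11, axialPartial]
    simp
    ring
  rw [hcongr, ← ofReal_integral_eq_lintegral_ofReal hint
    (Eventually.of_forall fun x => by positivity), integral_muOmega_eq hint]
  simp

/-- The normalization 2 makes ½∫r'² = λ for a wrinkle of amplitude √(λℓ) and width ℓ. Nonnegativity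
keeps the wrinkle above the obstacle. -/
theorem exists_profile : ∃ B : ℝ → ℝ, ContDiff ℝ ∞ B ∧ HasCompactSupport B ∧ (∀ z, 0 ≤ B z) ∧
    tsupport B ⊆ Ioo (-(1 / 2)) (1 / 2) ∧ ∫ z, deriv B z ^ 2 = 2 := by
  let b : ContDiffBump (0 : ℝ) := ⟨1 / 8, 1 / 4, by norm_num, by norm_num⟩
  have hb : ContDiff ℝ ∞ b := b.contDiff
  have hts : tsupport b ⊆ Ioo (-(1 / 2)) (1 / 2) := by
    rw [b.tsupport_eq]
    intro x hx
    have : |x| ≤ 1 / 4 := by simpa [b] using hx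
    constructor <;> linarith [abs_le.1 this]
  have hbc : HasCompactSupport b := b.hasCompactSupport
  have hdc : Continuous (deriv b) := hb.continuous_deriv (by simp)
  have hd : HasCompactSupport fun z => deriv b z ^ 2 :=
    hbc.deriv.comp_left (g := fun y : ℝ => y ^ 2) (by simp)
  obtain ⟨z₀, hz₀⟩ : ∃ z, deriv b z ≠ 0 := by
    by_contra! hcon
    have h1 := is_const_of_deriv_eq_zero (hb.differentiable (by simp)) hcon 0 1
    have h2 : b 0 = 1 := b.one_of_mem_closedBall (by simp [b])
    have h3 : b 1 = 0 := image_eq_zero_of_notMem_tsupport fun hx => by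
      have := (hts hx).2
      norm_num at this
    rw [h2, h3] at h1
    exact one_ne_zero h1
  have hJ : 0 < ∫ z, deriv b z ^ 2 :=
    (hdc.pow 2).integral_pos_of_hasCompactSupport_nonneg_nonzero hd (fun z => sq_nonneg _)
      (x := z₀) (pow_ne_zero 2 hz₀)
  set J := ∫ z, deriv b z ^ 2
  refine ⟨fun z => √(2 / J) * b z, contDiff_const.mul hb, hbc.mul_left,
    fun z => mul_nonneg (Real.sqrt_nonneg _) b.nonneg,
    (tsupport_mul_subset_right (f := fun _ => √(2 / J))).trans hts, ?_⟩
  have : ∀ z, deriv (fun z => √(2 / J) * b z) z ^ 2 = 2 / J * deriv b z ^ 2 := fun z => by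
    rw [deriv_const_mul _ (hb.differentiable (by simp) z), mul_pow, Real.sq_sqrt (by positivity)]
  simp only [this]
  rw [integral_const_mul]
  exact div_mul_cancel₀ _ hJ.ne'

theorem integral_comp_div_of_support {F : ℝ → ℝ}
    (hs : ∀ z, z ∉ Ioo (-(1 / 2) : ℝ) (1 / 2) → F z = 0) {ℓ : ℝ} (h0 : 0 < ℓ) (h1 : ℓ ≤ 1) :
    ∫ z in (-(1 / 2) : ℝ)..(1 / 2), F (z / ℓ) = ℓ * ∫ z, F z := by
  rw [intervalIntegral.integral_eq_integral_of_support_subset, Measure.integral_comp_div,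
    abs_of_pos h0, smul_eq_mul]
  intro z hz
  have hm : z / ℓ ∈ Ioo (-(1 / 2) : ℝ) (1 / 2) := by
    by_contra hn
    exact hz (hs _ hn)
  obtain ⟨ha, hb⟩ := hm
  rw [lt_div_iff₀ h0] at ha
  rw [div_lt_iff₀ h0] at hb
  constructor <;> nlinarith

/-- A single axisymmetric wrinkle of width `ℓ`. -/
theorem exists_competitor : ∃ K : ℝ, 0 < K ∧ ∀ h lam δ ℓ : ℝ, 0 < lam → 0 ≤ δ → 0 < ℓ → ℓ ≤ 1 →
    ∃ ψ ∈ admissible lam (1 + δ) ∞, energy h ψ ≤ ENNReal.ofReal (2 * Real.pi * (δ ^ 2 +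
      K * (δ * (√(lam * ℓ) * ℓ) + lam * ℓ ^ 2 + h ^ 2 * (lam / ℓ ^ 2)))) := by
  obtain ⟨B, hB, hBc, hB0, hBs, hB2⟩ := exists_profile
  have hBd : ∀ z, HasDerivAt B (deriv B z) z := fun z =>
    (hB.differentiable (by simp) z).hasDerivAt
  have hB' : ContDiff ℝ ∞ (deriv B) := ((contDiff_infty_iff_deriv).1 hB).2
  have hBd' : ∀ z, HasDerivAt (deriv B) (deriv (deriv B) z) z := fun z =>
    (hB'.differentiable (by simp) z).hasDerivAt
  have hB'c := hB'.continuous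
  have hB'' : Continuous (deriv (deriv B)) := hB'.continuous_deriv (by simp)
  have z0 : ∀ z, z ∉ Ioo (-(1 / 2) : ℝ) (1 / 2) → B z = 0 := fun z hz =>
    image_eq_zero_of_notMem_tsupport fun h => hz (hBs h)
  have z1 : ∀ z, z ∉ Ioo (-(1 / 2) : ℝ) (1 / 2) → deriv B z = 0 := fun z hz => by
    by_contra h
    exact hz (hBs (support_deriv_subset h))
  have z2 : ∀ z, z ∉ Ioo (-(1 / 2) : ℝ) (1 / 2) → deriv (deriv B) z = 0 := fun z hz => by
    by_contra h
    exact hz (hBs (closure_minimal support_deriv_subset (isClosed_tsupport _)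
      (support_deriv_subset h)))
  have hBcont := hB.continuous
  set K₁ := ∫ z, B z
  set K₂ := ∫ z, B z ^ 2
  set K₃ := ∫ z, deriv (deriv B) z ^ 2
  have hK₁ : 0 ≤ K₁ := integral_nonneg hB0
  have hK₂ : 0 ≤ K₂ := integral_nonneg fun z => sq_nonneg _
  have hK₃ : 0 ≤ K₃ := integral_nonneg fun z => sq_nonneg _
  refine ⟨2 * K₁ + K₂ + K₃ + 1, by positivity, fun h lam δ ℓ hlam hδ hℓ hℓ1 => ?_⟩
  set s := √(lam * ℓ) with hs
  have hs2 : s ^ 2 = lam * ℓ := Real.sq_sqrt (by positivity)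
  have hs0 : 0 ≤ s := Real.sqrt_nonneg _
  let r : ℝ → ℝ := fun z => δ + s * B (z / ℓ)
  let r' : ℝ → ℝ := fun z => s / ℓ * deriv B (z / ℓ)
  let r'' : ℝ → ℝ := fun z => s / ℓ ^ 2 * deriv (deriv B) (z / ℓ)
  let ζ : ℝ → ℝ := fun z => ∫ y in (0 : ℝ)..z, -(1 / 2) * r' y ^ 2
  have hr'c : Continuous r' := by fun_prop
  have hr''c : Continuous r'' := by fun_prop
  have hr : ∀ z, HasDerivAt r (r' z) z := fun z => by
    have := (((hBd (z / ℓ)).comp z ((hasDerivAt_id z).div_const ℓ)).const_mul s).const_add δ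
    exact this.congr_deriv (by simp only [r']; ring)
  have hr' : ∀ z, HasDerivAt r' (r'' z) z := fun z => by
    have := ((hBd' (z / ℓ)).comp z ((hasDerivAt_id z).div_const ℓ)).const_mul (s / ℓ)
    exact this.congr_deriv (by simp only [r'']; field_simp)
  have hζ : ∀ z, HasDerivAt ζ (-(1 / 2) * r' z ^ 2) z := fun z =>
    intervalIntegral.integral_hasDerivAt_right (Continuous.intervalIntegrable (by fun_prop) _ _)
      (Continuous.stronglyMeasurableAtFilter (by fun_prop) _ _)
      (Continuous.continuousAt (by fun_prop))
  have m1 : (1 / 2 : ℝ) / ℓ ∉ Ioo (-(1 / 2) : ℝ) (1 / 2) := fun hm => by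
    have := hm.2
    rw [div_lt_iff₀ hℓ] at this
    linarith
  have m2 : (-(1 / 2) : ℝ) / ℓ ∉ Ioo (-(1 / 2) : ℝ) (1 / 2) := fun hm => by
    have := hm.1
    rw [lt_div_iff₀ hℓ] at this
    linarith
  have p0 : r (1 / 2) = r (-(1 / 2)) := by simp only [r, z0 _ m1, z0 _ m2]
  have p1 : r' (1 / 2) = r' (-(1 / 2)) := by simp only [r', z1 _ m1, z1 _ m2]
  have j1 : ∫ z in (-(1 / 2) : ℝ)..(1 / 2), B (z / ℓ) = ℓ * K₁ :=
    integral_comp_div_of_support z0 hℓ hℓ1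
  have j2 : ∫ z in (-(1 / 2) : ℝ)..(1 / 2), B (z / ℓ) ^ 2 = ℓ * K₂ :=
    integral_comp_div_of_support (F := fun z => B z ^ 2)
      (fun z hz => by simp [z0 z hz]) hℓ hℓ1
  have j3 : ∫ z in (-(1 / 2) : ℝ)..(1 / 2), deriv (deriv B) (z / ℓ) ^ 2 = ℓ * K₃ :=
    integral_comp_div_of_support (F := fun z => deriv (deriv B) z ^ 2)
      (fun z hz => by simp [z2 z hz]) hℓ hℓ1
  have j4 : ∫ z in (-(1 / 2) : ℝ)..(1 / 2), deriv B (z / ℓ) ^ 2 = ℓ * 2 :=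
    (integral_comp_div_of_support (F := fun z => deriv B z ^ 2)
      (fun z hz => by simp [z1 z hz]) hℓ hℓ1).trans (by rw [hB2])
  -- The wrinkle shortens the cylinder by exactly λ, which is the required boundary condition.
  have hζp : ζ (1 / 2) + lam * (1 / 2) = ζ (-(1 / 2)) + lam * (-(1 / 2)) := by
    have h1 : ζ (1 / 2) - ζ (-(1 / 2)) = ∫ y in (-(1 / 2) : ℝ)..(1 / 2), -(1 / 2) * r' y ^ 2 :=
      intervalIntegral.integral_interval_sub_left
        (Continuous.intervalIntegrable (by fun_prop) _ _)
        (Continuous.intervalIntegrable (by fun_prop) _ _)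
    have h2 : ∫ y in (-(1 / 2) : ℝ)..(1 / 2), -(1 / 2) * r' y ^ 2 = -lam := by
      simp only [r', mul_pow, intervalIntegral.integral_const_mul, j4, div_pow, hs2]
      field_simp
    linarith
  refine ⟨⟨fun x => r x.2, fun _ => 0, fun x => ζ x.2⟩, ⟨?_, ?_, ?_, ?_, fun _ _ => le_top⟩, ?_⟩
  · exact memH2Per_axial hr hr' hr''c p0 p1
  · exact memH1Per_axial (g := fun _ => 0) (g' := fun _ => 0) (fun z => hasDerivAt_const z 0)
      continuous_const rfl
  · exact memH1Per_axial (g := fun z => ζ z + lam * z)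
      (g' := fun z => -(1 / 2) * r' z ^ 2 + lam)
      (fun z => ((hζ z).add ((hasDerivAt_id z).const_mul lam)).congr_deriv (by simp)) (by fun_prop) hζp
  · refine Eventually.of_forall fun x => ?_
    have := mul_nonneg hs0 (hB0 (x.2 / ℓ))
    simp only [r]
    linarith
  · rw [energy_axial hr hr' hr''c hζ p1]
    refine ENNReal.ofReal_le_ofReal (mul_le_mul_of_nonneg_left ?_ Real.two_pi_pos.le)
    have e : ∀ z, r z ^ 2 + h ^ 2 * r'' z ^ 2 = δ ^ 2 + (2 * δ * s) * B (z / ℓ) +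
        s ^ 2 * B (z / ℓ) ^ 2 + (h ^ 2 * s ^ 2 / ℓ ^ 4) * deriv (deriv B) (z / ℓ) ^ 2 := fun z => by
      simp only [r, r'']
      field_simp
      ring
    have hii : ∀ f : ℝ → ℝ, Continuous f →
      IntervalIntegrable f volume (-(1 / 2)) (1 / 2) := fun f hf => hf.intervalIntegrable _ _
    simp only [e]
    rw [intervalIntegral.integral_add (hii _ (by fun_prop)) (hii _ (by fun_prop)),
      intervalIntegral.integral_add (hii _ (by fun_prop)) (hii _ (by fun_prop)),
      intervalIntegral.integral_add (hii _ (by fun_prop)) (hii _ (by fun_prop)),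
      intervalIntegral.integral_const, intervalIntegral.integral_const_mul,
      intervalIntegral.integral_const_mul, intervalIntegral.integral_const_mul, j1, j2, j3, hs2]
    have t1 : 0 ≤ δ * (s * ℓ) := by positivity
    have t2 : 0 ≤ lam * ℓ ^ 2 := by positivity
    have t3 : 0 ≤ h ^ 2 * (lam / ℓ ^ 2) := by positivity
    have t4 : h ^ 2 * (lam * ℓ) / ℓ ^ 4 * (ℓ * K₃) = h ^ 2 * (lam / ℓ ^ 2) * K₃ := by
      field_simp
    rw [t4]
    simp only [smul_eq_mul]
    nlinarith [mul_nonneg t1 hK₁, mul_nonneg t1 hK₂, mul_nonneg t1 hK₃, mul_nonneg t2 hK₁,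
      mul_nonneg t2 hK₂, mul_nonneg t2 hK₃, mul_nonneg t3 hK₁, mul_nonneg t3 hK₂,
      mul_nonneg t3 hK₃]

/-! ### Lower bounds on the energy -/

theorem IsWeakPartial.sub {i : Fin 2} {f₁ g₁ f₂ g₂ : ℝ × ℝ → ℝ} (h₁ : IsWeakPartial i f₁ g₁)
    (h₂ : IsWeakPartial i f₂ g₂) (hf₁ : MemLp f₁ 2 muOmega) (hg₁ : MemLp g₁ 2 muOmega)
    (hf₂ : MemLp f₂ 2 muOmega) (hg₂ : MemLp g₂ 2 muOmega) :
    IsWeakPartial i (fun x => f₁ x - f₂ x) (fun x => g₁ x - g₂ x) := by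
  refine ⟨h₁.1.sub h₂.1, h₁.2.1.sub h₂.2.1, fun ψ hψ => ?_⟩
  have hc := hψ.1.continuous
  have hd : Continuous fun x => fderiv ℝ ψ x (basisVec i) :=
    (hψ.1.continuous_fderiv (by simp)).clm_apply continuous_const
  have key : ∀ {f k : ℝ × ℝ → ℝ}, MemLp f 2 muOmega → Continuous k →
      Integrable (fun x => f x * k x) muOmega := fun hf hk =>
    hf.integrable_mul (memLp_of_continuous hk 2)
  simp only [sub_mul]
  rw [integral_sub (key hf₁ hd) (key hf₂ hd), integral_sub (key hg₁ hc) (key hg₂ hc),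
    h₁.2.2 ψ hψ, h₂.2.2 ψ hψ]
  ring

/-- Only φ_z + λz is assumed to lie in the periodic space; this recovers the derivatives of φ_z,
which enter the strain. -/
theorem weakPartial_sub_linear_ae_eq {lam : ℝ} {f : ℝ × ℝ → ℝ}
    (h : MemH1Per fun x => f x + lam * x.2) (i : Fin 2) :
    weakPartial i f =ᵐ[muOmega]
      fun x => weakPartial i (fun x => f x + lam * x.2) x - axialPartial (fun _ => lam) i x := by
  have hd : ∀ z : ℝ, HasDerivAt (fun z => lam * z) lam z := fun z => by
    simpa using (hasDerivAt_id z).const_mul lam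
  have h2 := isWeakPartial_axial (g' := fun _ => lam) hd continuous_const i
  have h3 := (h.1.isWeakPartial i).sub h2 h.1.1 (h.1.memLp_weakPartial i)
    (memLp_of_continuous (by fun_prop) 2)
    (memLp_of_continuous (continuous_axialPartial continuous_const i) 2)
  simp only [add_sub_cancel_right] at h3
  exact weakPartial_ae_eq h3

theorem strain_zero_zero (φ : Displacement) (x : ℝ × ℝ) : strain φ x 0 0 =
    weakPartial 0 φ.theta x + 1 / 2 * weakPartial 0 φ.rho x ^ 2 + φ.rho x := by
  simp [strain, Displacement.inCyl]
  ring

theorem strain_one_one (φ : Displacement) (x : ℝ × ℝ) : strain φ x 1 1 =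
    weakPartial 1 φ.z x + 1 / 2 * weakPartial 1 φ.rho x ^ 2 := by
  simp [strain, Displacement.inCyl]
  ring

section LowerBound

variable {lam varrho : ℝ} {m : ℝ≥0∞} {φ : Displacement}

theorem aestronglyMeasurable_weakPartial_inCyl (hφ : φ ∈ admissible lam varrho m) (i j : Fin 2) :
    AEStronglyMeasurable (weakPartial i (φ.inCyl j)) muOmega := by
  fin_cases j
  · exact (hφ.2.1.1.memLp_weakPartial i).aestronglyMeasurable
  · have hm := memLp_of_continuous
      (continuous_axialPartial (g' := fun _ => lam) continuous_const i) 2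
    exact (((hφ.2.2.1.1.memLp_weakPartial i).sub hm).ae_eq
      (weakPartial_sub_linear_ae_eq hφ.2.2.1 i).symm).aestronglyMeasurable

theorem aestronglyMeasurable_strain (hφ : φ ∈ admissible lam varrho m) (i j : Fin 2) :
    AEStronglyMeasurable (fun x => strain φ x i j) muOmega := by
  have hin := aestronglyMeasurable_weakPartial_inCyl hφ
  have hr := fun i => (hφ.1.1.1.memLp_weakPartial i).aestronglyMeasurable
  have hsym : AEStronglyMeasurable
      (fun x => (weakPartial i (φ.inCyl j) x + weakPartial j (φ.inCyl i) x) / 2) muOmega := by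
    simp only [div_eq_mul_inv]
    exact ((hin i j).add (hin j i)).mul_const _
  refine (hsym.add (((hr i).mul (hr j)).const_mul _)).add ?_
  split_ifs
  · exact hφ.1.1.1.1.aestronglyMeasurable
  · exact aestronglyMeasurable_const

/-- For finite energy, the energy controls the diagonal strains and the axial bending. -/
theorem exists_energy_lower_bound (hφ : φ ∈ admissible lam varrho m) {h : ℝ}
    (hfin : energy h φ ≠ ⊤) :
    MemLp (fun x => strain φ x 0 0) 2 muOmega ∧ MemLp (fun x => strain φ x 1 1) 2 muOmega ∧
      (∫ x, strain φ x 0 0 ^ 2 ∂muOmega) + (∫ x, strain φ x 1 1 ^ 2 ∂muOmega) +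
        h ^ 2 * ∫ x, weakPartial 1 (weakPartial 1 φ.rho) x ^ 2 ∂muOmega ≤
      (energy h φ).toReal := by
  have hs := aestronglyMeasurable_strain hφ
  have hu : ∀ i j, MemLp (weakPartial i (weakPartial j φ.rho)) 2 muOmega := fun i j =>
    (hφ.1.2 j).1.memLp_weakPartial i
  set d : ℝ × ℝ → ℝ := fun x => (∑ i, ∑ j, strain φ x i j ^ 2)
      + h ^ 2 * ∑ i, ∑ j, weakPartial i (weakPartial j φ.rho) x ^ 2 with hd
  have hd0 : ∀ x, 0 ≤ d x := fun x => by positivity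
  have hdm : AEStronglyMeasurable d muOmega := by
    simp only [hd, Fin.sum_univ_two]
    have h1 := fun i j => (hs i j).pow 2
    have h2 := fun i j => (hu i j).aestronglyMeasurable.pow 2
    exact (((h1 0 0).add (h1 0 1)).add ((h1 1 0).add (h1 1 1))).add
      ((((h2 0 0).add (h2 0 1)).add ((h2 1 0).add (h2 1 1))).const_mul _)
  -- Admissibility is not used to make the strains square integrable, as they contain products of
  -- derivatives of φ_ρ; finite energy provides this.
  have hdi : Integrable d muOmega :=
    (lintegral_ofReal_ne_top_iff_integrable hdm (Eventually.of_forall hd0)).1 hfin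
  have hle : ∀ x, strain φ x 0 0 ^ 2 + strain φ x 1 1 ^ 2 +
      h ^ 2 * weakPartial 1 (weakPartial 1 φ.rho) x ^ 2 ≤ d x := fun x => by
    simp only [hd, Fin.sum_univ_two]
    have h1 := fun i j => sq_nonneg (strain φ x i j)
    have h2 := fun i j => mul_nonneg (sq_nonneg h)
      (sq_nonneg (weakPartial i (weakPartial j φ.rho) x))
    linarith [h1 0 1, h1 1 0, h2 0 0, h2 0 1, h2 1 0]
  have hq : ∀ i : Fin 2, (∀ x, strain φ x i i ^ 2 ≤ d x) →
      Integrable (fun x => strain φ x i i ^ 2) muOmega := fun i hi =>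
    hdi.mono' ((hs i i).pow 2) (Eventually.of_forall fun x => by
      rw [Real.norm_of_nonneg (sq_nonneg _)]
      exact hi x)
  have hb : ∀ x, 0 ≤ h ^ 2 * weakPartial 1 (weakPartial 1 φ.rho) x ^ 2 := fun x => by positivity
  have q0 := hq 0 fun x => by linarith [hle x, hb x, sq_nonneg (strain φ x 1 1)]
  have q1 := hq 1 fun x => by linarith [hle x, hb x, sq_nonneg (strain φ x 0 0)]
  have q2 := ((hu 1 1).integrable_sq).const_mul (h ^ 2)
  have q01 : Integrable (fun x => strain φ x 0 0 ^ 2 + strain φ x 1 1 ^ 2) muOmega := q0.add q1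
  refine ⟨(memLp_two_iff_integrable_sq (hs 0 0)).2 q0, (memLp_two_iff_integrable_sq (hs 1 1)).2 q1,
    ?_⟩
  rw [← integral_const_mul, ← integral_add q0 q1, ← integral_add q01 q2]
  have e : (energy h φ).toReal = ∫ x, d x ∂muOmega :=
    (integral_eq_lintegral_of_nonneg_ae (Eventually.of_forall hd0) hdm).symm
  rw [e]
  exact integral_mono (q01.add q2) hdi hle

theorem integral_strain_one_one (hφ : φ ∈ admissible lam varrho m) :
    ∫ x, strain φ x 1 1 ∂muOmega =
      -(2 * Real.pi * lam) + 1 / 2 * ∫ x, weakPartial 1 φ.rho x ^ 2 ∂muOmega := by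
  have h := hφ.2.2.1
  have hp := h.1.integrable_weakPartial 1
  have hq := (hφ.1.1.1.memLp_weakPartial 1).integrable_sq
  have hpl : Integrable (fun x => weakPartial 1 (fun x => φ.z x + lam * x.2) x - lam) muOmega :=
    hp.sub (integrable_const _)
  have e : (fun x => strain φ x 1 1) =ᵐ[muOmega] fun x =>
      (weakPartial 1 (fun x => φ.z x + lam * x.2) x - lam) +
        1 / 2 * weakPartial 1 φ.rho x ^ 2 := by
    filter_upwards [weakPartial_sub_linear_ae_eq h 1] with x hx
    rw [strain_one_one, hx]
    rfl
  rw [integral_congr_ae e, integral_add hpl (hq.const_mul _),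
    integral_sub hp (integrable_const _), h.integral_weakPartial, integral_const_muOmega,
    integral_const_mul]
  ring

/-- With δ = ϱ - 1, integrate ε² ≥ 2δε - δ² for the hoop strain ε. Periodicity removes ∂_θφ_θ from
its mean, the quadratic term only helps, and the obstacle turns ∫(φ_ρ - δ) into an L¹ norm. Hence
the deviation is controlled linearly. -/
theorem integral_strain_zero_zero_sq (hφ : φ ∈ admissible lam varrho m) (hv : 1 ≤ varrho)
    (hs : MemLp (fun x => strain φ x 0 0) 2 muOmega) :
    2 * Real.pi * (varrho - 1) ^ 2 +
        2 * (varrho - 1) * ∫ x, |φ.rho x - (varrho - 1)| ∂muOmega ≤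
      ∫ x, strain φ x 0 0 ^ 2 ∂muOmega := by
  set δ := varrho - 1 with hδ
  have hδ0 : 0 ≤ δ := by linarith
  have hq := (hφ.1.1.1.memLp_weakPartial 0).integrable_sq
  have ht := hφ.2.1.1.integrable_weakPartial 0
  have hr := hφ.1.1.1.integrable
  have i0 : Integrable (fun x => strain φ x 0 0) muOmega := hs.integrable (by norm_num)
  have e1 : ∫ x, strain φ x 0 0 ∂muOmega =
      1 / 2 * ∫ x, weakPartial 0 φ.rho x ^ 2 ∂muOmega + ∫ x, φ.rho x ∂muOmega := by
    have htq : Integrable (fun x => weakPartial 0 φ.theta x + 1 / 2 * weakPartial 0 φ.rho x ^ 2)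
        muOmega := ht.add (hq.const_mul _)
    simp only [strain_zero_zero]
    rw [integral_add htq hr, integral_add ht (hq.const_mul _),
      hφ.2.1.integral_weakPartial, integral_const_mul, zero_add]
  have e2 : ∫ x, |φ.rho x - δ| ∂muOmega = ∫ x, φ.rho x ∂muOmega - 2 * Real.pi * δ := by
    rw [← integral_const_muOmega, ← integral_sub hr (integrable_const _)]
    refine integral_congr_ae ?_
    filter_upwards [hφ.2.2.2.1] with x hx
    exact abs_of_nonneg (by linarith)
  have e3 : 2 * δ * ∫ x, strain φ x 0 0 ∂muOmega - 2 * Real.pi * δ ^ 2 ≤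
      ∫ x, strain φ x 0 0 ^ 2 ∂muOmega := by
    rw [← integral_const_muOmega, ← integral_const_mul,
      ← integral_sub (i0.const_mul _) (integrable_const _)]
    refine integral_mono ((i0.const_mul _).sub (integrable_const _)) hs.integrable_sq fun x => ?_
    simp only
    nlinarith [sq_nonneg (strain φ x 0 0 - δ)]
  have e4 : 0 ≤ ∫ x, weakPartial 0 φ.rho x ^ 2 ∂muOmega := integral_nonneg fun x => sq_nonneg _
  rw [e1] at e3
  rw [e2]
  nlinarith [mul_nonneg hδ0 e4]

end LowerBound

/-- Cauchy–Schwarz with |Ω| = 2π, obtained by expanding ∫(2πf - ∫f)² ≥ 0. -/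
theorem sq_integral_muOmega_le {f : ℝ × ℝ → ℝ} (hf : MemLp f 2 muOmega) :
    (∫ x, f x ∂muOmega) ^ 2 ≤ 2 * Real.pi * ∫ x, f x ^ 2 ∂muOmega := by
  have hi : Integrable f muOmega := hf.integrable (by norm_num)
  set a := ∫ x, f x ∂muOmega with ha
  have h0 : 0 ≤ ∫ x, (2 * Real.pi * f x - a) ^ 2 ∂muOmega := integral_nonneg fun x => sq_nonneg _
  have h1 : ∫ x, (2 * Real.pi * f x - a) ^ 2 ∂muOmega =
      ∫ x, ((2 * Real.pi) ^ 2 * f x ^ 2 - (2 * (2 * Real.pi) * a * f x - a ^ 2)) ∂muOmega :=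
    integral_congr_ae (Eventually.of_forall fun x => by simp only; ring)
  have h4 : Integrable (fun x => 2 * (2 * Real.pi) * a * f x - a ^ 2) muOmega :=
    (hi.const_mul _).sub (integrable_const _)
  rw [h1, integral_sub (hf.integrable_sq.const_mul _) h4, integral_sub (hi.const_mul _)
    (integrable_const _), integral_const_mul, integral_const_mul, integral_const_muOmega,
    ← ha] at h0
  have h2 := Real.two_pi_pos
  have h3 : 0 ≤ 2 * Real.pi * (2 * Real.pi * ∫ x, f x ^ 2 ∂muOmega - a ^ 2) := by nlinarith
  linarith [nonneg_of_mul_nonneg_right h3 h2]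

/-! ### Blow-up of the slope -/

theorem ae_abs_weakPartial_le_radialSlope {φ : Displacement} (h : radialSlope φ ≠ ⊤) :
    ∀ᵐ x ∂muOmega, |weakPartial 1 φ.rho x| ≤ (radialSlope φ).toReal := by
  have key : ∀ᵐ x ∂muOmega, ‖√(∑ i, weakPartial i φ.rho x ^ 2)‖ₑ ≤ radialSlope φ := by
    rw [radialSlope, eLpNorm_exponent_top]
    exact ae_le_eLpNormEssSup
  filter_upwards [key] with x hx
  have h1 := ENNReal.toReal_mono h hx
  rw [toReal_enorm, Real.norm_of_nonneg (Real.sqrt_nonneg _)] at h1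
  refine (Real.abs_le_sqrt ?_).trans h1
  rw [Fin.sum_univ_two]
  linarith [sq_nonneg (weakPartial 0 φ.rho x)]

/-- The optimal wrinkle width `ℓ`. -/
theorem exists_wrinkle_width {h lam δ : ℝ} (h0 : 0 < h) (h1 : h ≤ 1) (hlam : 0 < lam) (hδ : 0 < δ)
    (hle : lam ^ (1 / 2 : ℝ) * h ^ (1 / 4 : ℝ) ≤ δ) :
    ∃ ℓ : ℝ, 0 < ℓ ∧ ℓ ≤ 1 ∧ δ * (√(lam * ℓ) * ℓ) = h ^ 2 * (lam / ℓ ^ 2) ∧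
      lam * ℓ ^ 2 ≤ h ^ 2 * (lam / ℓ ^ 2) ∧
      lam / √(lam * ℓ) = δ ^ (1 / 7 : ℝ) * h ^ (-(2 / 7) : ℝ) * lam ^ (3 / 7 : ℝ) ∧
      h ^ 2 * (lam / ℓ ^ 2) =
        lam ^ 2 * (h / (δ ^ (-(2 / 3) : ℝ) * lam ^ (3 / 2 : ℝ))) ^ (6 / 7 : ℝ) := by
  -- In logarithmic variables every power law below becomes a linear relation among exponents.
  obtain ⟨a, rfl⟩ : ∃ a, h = Real.exp a := ⟨_, (Real.exp_log h0).symm⟩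
  obtain ⟨b, rfl⟩ : ∃ b, lam = Real.exp b := ⟨_, (Real.exp_log hlam).symm⟩
  obtain ⟨d, rfl⟩ : ∃ d, δ = Real.exp d := ⟨_, (Real.exp_log hδ).symm⟩
  have hsq : ∀ x, √(Real.exp x) = Real.exp (x / 2) := fun x => (Real.exp_half x).symm
  have hpow : ∀ x, Real.exp x ^ 2 = Real.exp (2 * x) := fun x => by
    rw [← Real.exp_nat_mul]; norm_num
  rw [Real.exp_le_one_iff] at h1
  simp only [← Real.exp_mul, ← Real.exp_add, Real.exp_le_exp] at hle
  refine ⟨Real.exp ((4 * a + b - 2 * d) / 7), Real.exp_pos _, ?_, ?_, ?_, ?_, ?_⟩ <;>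
  simp only [← Real.exp_mul, ← Real.exp_add, ← Real.exp_sub, hsq, hpow, Real.exp_le_exp,
    Real.exp_le_one_iff, Real.exp_eq_exp] <;>
  linarith

/-- The non-asymptotic core: the little-o hypothesis is replaced by an inequality with a fixed
constant c, so both asymptotic statements follow at once. -/
theorem radialSlope_lower_bound : ∃ C c : ℝ, 0 < C ∧ 0 < c ∧
    ∀ (h lam varrho : ℝ) (φ : Displacement), h ∈ Ioc (0 : ℝ) (1 / 2) → lam ∈ Ioc (0 : ℝ) (1 / 2) →
      1 + lam ^ (1 / 2 : ℝ) * h ^ (1 / 4 : ℝ) ≤ varrho →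
      h ≤ c * ((varrho - 1) ^ (-(2 / 3) : ℝ) * lam ^ (3 / 2 : ℝ)) →
      IsMinimizer h lam varrho ⊤ φ →
      ENNReal.ofReal ((varrho - 1) ^ (1 / 7 : ℝ) * h ^ (-(2 / 7) : ℝ) * lam ^ (3 / 7 : ℝ)) ≤
        ENNReal.ofReal C * radialSlope φ := by
  obtain ⟨K, hK, hcomp⟩ := exists_competitor
  refine ⟨12 * K * √(6 * K), (1 / (12 * K)) ^ (7 / 6 : ℝ), by positivity, by positivity, ?_⟩
  intro h lam varrho φ ⟨h0, h1⟩ ⟨hlam, _⟩ hrho hsmall hφ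
  have hδ : 0 < varrho - 1 := by
    have : 0 < lam ^ (1 / 2 : ℝ) * h ^ (1 / 4 : ℝ) := by positivity
    linarith
  obtain ⟨ℓ, hℓ, hℓ1, e1, e2, e3, e4⟩ :=
    exists_wrinkle_width h0 (by linarith) hlam hδ (by linarith)
  rw [← e3]
  by_cases htop : radialSlope φ = ⊤
  · rw [htop, ENNReal.mul_top (by simpa using (by positivity : 0 < 12 * K * √(6 * K)))]
    exact le_top
  obtain ⟨hadm, hmin⟩ := hφ
  set δ := varrho - 1 with hδdef
  set E := h ^ 2 * (lam / ℓ ^ 2) with hE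
  set M := (radialSlope φ).toReal with hM
  have hE0 : 0 < E := by positivity
  -- E is λ² times the 6/7 power of the small ratio, hence the exponent 7/6 in c.
  have hsmallE : 12 * K * E ≤ lam ^ 2 := by
    have hb : h / (δ ^ (-(2 / 3) : ℝ) * lam ^ (3 / 2 : ℝ)) ≤ (1 / (12 * K)) ^ (7 / 6 : ℝ) :=
      (div_le_iff₀ (by positivity)).2 hsmall
    have hb2 := Real.rpow_le_rpow (by positivity) hb (by norm_num : (0 : ℝ) ≤ 6 / 7)
    rw [← Real.rpow_mul (by positivity)] at hb2
    norm_num at hb2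
    rw [e4]
    calc 12 * K * (lam ^ 2 * (h / (δ ^ (-(2 / 3) : ℝ) * lam ^ (3 / 2 : ℝ))) ^ (6 / 7 : ℝ))
        ≤ 12 * K * (lam ^ 2 * (1 / (12 * K))) := by
          gcongr
          simpa using hb2
      _ = lam ^ 2 := by field_simp
  obtain ⟨ψ, hψ, hψE⟩ := hcomp h lam δ ℓ hlam hδ.le hℓ hℓ1
  rw [show 1 + δ = varrho by rw [hδdef]; ring] at hψ
  have hen := (hmin ψ hψ).trans hψE
  have hfin : energy h φ ≠ ⊤ := (hen.trans_lt ENNReal.ofReal_lt_top).ne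
  have hup : (energy h φ).toReal ≤ 2 * Real.pi * (δ ^ 2 + K * (3 * E)) := by
    refine ENNReal.toReal_le_of_le_ofReal (by positivity) (hen.trans (ENNReal.ofReal_le_ofReal ?_))
    rw [e1]
    gcongr
    linarith
  obtain ⟨s0, s1, hlow⟩ := exists_energy_lower_bound hadm hfin
  have hlow0 := integral_strain_zero_zero_sq hadm (by linarith) s0
  have hlow1 := sq_integral_muOmega_le s1
  rw [integral_strain_one_one hadm] at hlow1
  have hM0 : 0 ≤ M := ENNReal.toReal_nonneg
  set κ := √(6 * K) with hκ
  have hκ0 : 0 < κ := by positivity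
  have hκ2 : κ ^ 2 = 6 * K := Real.sq_sqrt (by positivity)
  -- The length t = ℓ/κ with κ² = 6K is chosen so that the bending term is at most πλ/2, half of the
  -- lower bound πλ for ½V.
  have hint := integral_sq_weakPartial_le hadm.1.1 (hadm.1.2 1) (t := ℓ / κ)
    (by positivity) hM0 (ae_abs_weakPartial_le_radialSlope htop) δ
  set W := ∫ x, |φ.rho x - δ| ∂muOmega
  set V := ∫ x, weakPartial 1 φ.rho x ^ 2 ∂muOmega
  set U := ∫ x, weakPartial 1 (weakPartial 1 φ.rho) x ^ 2 ∂muOmega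
  set S := ∫ x, strain φ x 1 1 ^ 2 ∂muOmega
  have hπ := Real.pi_pos
  have hW0 : 0 ≤ W := integral_nonneg fun x => abs_nonneg _
  have hU0 : 0 ≤ h ^ 2 * U := mul_nonneg (sq_nonneg h) (integral_nonneg fun x => sq_nonneg _)
  have hS0 : 0 ≤ S := integral_nonneg fun x => sq_nonneg _
  have hδW0 : 0 ≤ δ * W := mul_nonneg hδ.le hW0
  -- The bulk terms 2πδ² of the upper and lower bounds cancel here.
  have hexcess : 2 * (δ * W) + S + h ^ 2 * U ≤ 6 * Real.pi * (K * E) := by nlinarith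
  have hV : Real.pi * lam ≤ 1 / 2 * V := by
    have : (-(2 * Real.pi * lam) + 1 / 2 * V) ^ 2 ≤ (Real.pi * lam) ^ 2 := by
      calc _ ≤ 2 * Real.pi * S := hlow1
        _ ≤ 2 * Real.pi * (6 * Real.pi * (K * E)) := by gcongr; linarith
        _ = Real.pi ^ 2 * (12 * K * E) := by ring
        _ ≤ Real.pi ^ 2 * lam ^ 2 := by gcongr
        _ = _ := by ring
    have := abs_le_of_sq_le_sq this (by positivity)
    linarith [(abs_le.1 this).1]
  have hbend : (ℓ / κ) ^ 2 / 2 * U ≤ Real.pi * lam / 2 := by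
    have hU : h ^ 2 * U ≤ 6 * Real.pi * (K * E) := by linarith
    have e5 : h ^ 2 * ((ℓ / κ) ^ 2 / 2 * U) = ℓ ^ 2 / (12 * K) * (h ^ 2 * U) := by
      rw [div_pow, hκ2]
      field_simp
      ring
    have e6 : h ^ 2 * (Real.pi * lam / 2) = ℓ ^ 2 / (12 * K) * (6 * Real.pi * (K * E)) := by
      rw [hE]
      field_simp
      ring
    refine le_of_mul_le_mul_left ?_ (pow_pos h0 2)
    rw [e5, e6]
    gcongr
  have hmain : Real.pi * lam / 2 ≤ 2 * M / (ℓ / κ) * W := by linarith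
  have hWle : W ≤ 3 * Real.pi * K * (√(lam * ℓ) * ℓ) := by
    refine le_of_mul_le_mul_left ?_ hδ
    calc δ * W ≤ 3 * Real.pi * K * E := by linarith
      _ = δ * (3 * Real.pi * K * (√(lam * ℓ) * ℓ)) := by rw [← e1]; ring
  have hfinal : lam / √(lam * ℓ) ≤ 12 * K * κ * M := by
    rw [div_le_iff₀ (by positivity)]
    have : 2 * M / (ℓ / κ) * W ≤ 2 * M / (ℓ / κ) * (3 * Real.pi * K * (√(lam * ℓ) * ℓ)) := by
      gcongr
    have e7 : 2 * M / (ℓ / κ) * (3 * Real.pi * K * (√(lam * ℓ) * ℓ)) =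
        Real.pi / 2 * (12 * K * κ * M * √(lam * ℓ)) := by
      field_simp
      ring
    refine le_of_mul_le_mul_left ?_ (half_pos hπ)
    linarith
  calc ENNReal.ofReal (lam / √(lam * ℓ)) ≤ ENNReal.ofReal (12 * K * κ * M) :=
        ENNReal.ofReal_le_ofReal hfinal
    _ = ENNReal.ofReal (12 * K * κ) * radialSlope φ := by
        rw [ENNReal.ofReal_mul (by positivity), hM, ENNReal.ofReal_toReal htop]

end VKD

end

theorem mainTheorem8 :
    (∃ C : ℝ, 0 < C ∧
      ∀ (h lam varrho : ℝ → ℝ) (φ : ℝ → VKD.Displacement),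
        (∀ α > 0, h α ∈ Ioc (0 : ℝ) (1 / 2)) →
        (∀ α > 0, lam α ∈ Ioc (0 : ℝ) (1 / 2)) →
        (∀ α > 0, 1 + lam α ^ (1 / 2 : ℝ) * h α ^ (1 / 4 : ℝ) ≤ varrho α) →
        (h =o[atTop] fun α => (varrho α - 1) ^ (-(2 / 3) : ℝ) * lam α ^ (3 / 2 : ℝ)) →
        (∀ α > 0, VKD.IsMinimizer (h α) (lam α) (varrho α) ∞ (φ α)) →
        ∀ᶠ α in atTop,
          ENNReal.ofReal ((varrho α - 1) ^ (1 / 7 : ℝ) * h α ^ (-(2 / 7) : ℝ)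
              * lam α ^ (3 / 7 : ℝ))
            ≤ ENNReal.ofReal C * VKD.radialSlope (φ α)) ∧
    (∀ (lam varrho : ℝ) (φ : ℝ → VKD.Displacement),
        lam ∈ Ioc (0 : ℝ) (1 / 2) → 1 < varrho →
        (∀ h ∈ Ioc (0 : ℝ) (1 / 2), VKD.IsMinimizer h lam varrho ∞ (φ h)) →
        Tendsto (fun h => VKD.radialSlope (φ h)) (𝓝[>] 0) (𝓝 ∞)) := by
  obtain ⟨C, c, hC, hc, key⟩ := VKD.radialSlope_lower_bound
  refine ⟨⟨C, hC, ?_⟩, ?_⟩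
  · intro h lam varrho φ hh hlam hrho ho hmin
    filter_upwards [ho.bound hc, eventually_gt_atTop 0] with α h1 h2
    have hδ : 0 ≤ varrho α - 1 := by
      have : 0 ≤ lam α ^ (1 / 2 : ℝ) * h α ^ (1 / 4 : ℝ) :=
        mul_nonneg (Real.rpow_nonneg (hlam α h2).1.le _) (Real.rpow_nonneg (hh α h2).1.le _)
      linarith [hrho α h2]
    rw [Real.norm_of_nonneg (hh α h2).1.le, Real.norm_of_nonneg (mul_nonneg
      (Real.rpow_nonneg hδ _) (Real.rpow_nonneg (hlam α h2).1.le _))] at h1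
    exact key _ _ _ _ (hh α h2) (hlam α h2) (hrho α h2) h1 (hmin α h2)
  · intro lam varrho φ hlam hrho hmin
    have hlam0 := hlam.1
    have hδ : 0 < varrho - 1 := by linarith
    -- For fixed ϱ > 1 and λ the lower bound grows like h^{-2/7}, and both conditions relating h to
    -- ϱ and λ hold once h is small.
    have l1 : Tendsto (fun h : ℝ => (varrho - 1) ^ (1 / 7 : ℝ) * h ^ (-(2 / 7) : ℝ)
        * lam ^ (3 / 7 : ℝ) / C) (𝓝[>] 0) atTop :=
      (((tendsto_rpow_neg_nhdsGT_zero (by norm_num)).const_mul_atTop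
        (Real.rpow_pos_of_pos hδ _)).atTop_mul_const (Real.rpow_pos_of_pos hlam0 _)).atTop_div_const
        hC
    refine tendsto_nhds_top_mono (ENNReal.tendsto_ofReal_atTop.comp l1) ?_
    have l2 : ∀ᶠ h : ℝ in 𝓝[>] 0, lam ^ (1 / 2 : ℝ) * h ^ (1 / 4 : ℝ) < varrho - 1 := by
      have ht : Tendsto (fun h : ℝ => lam ^ (1 / 2 : ℝ) * h ^ (1 / 4 : ℝ)) (𝓝[>] 0)
          (𝓝 (lam ^ (1 / 2 : ℝ) * (0 : ℝ) ^ (1 / 4 : ℝ))) :=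
        (((Real.continuous_rpow_const (by norm_num)).tendsto 0).mono_left
          nhdsWithin_le_nhds).const_mul _
      rw [Real.zero_rpow (by norm_num), mul_zero] at ht
      exact ht.eventually_lt_const hδ
    have l3 : 0 < c * ((varrho - 1) ^ (-(2 / 3) : ℝ) * lam ^ (3 / 2 : ℝ)) :=
      mul_pos hc (mul_pos (Real.rpow_pos_of_pos hδ _) (Real.rpow_pos_of_pos hlam0 _))
    filter_upwards [l2, Ioc_mem_nhdsGT (by norm_num : (0 : ℝ) < 1 / 2),
      Ioc_mem_nhdsGT l3] with h h1 h2 h3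
    have hk := key h lam varrho (φ h) h2 hlam (by linarith) h3.2 (hmin h h2)
    simp only [Function.comp_apply]
    rw [ENNReal.ofReal_div_of_pos hC]
    exact ENNReal.div_le_of_le_mul' hk
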